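/- **Conventions.** Let $k$ be a field. A *2-vector space* is a $k$-linear category that is $k$-linearly equivalent to $(\mathrm{Vect}_k^{fd})^n$ for some $n\ge 0$. A *graded 2-vector space* is a sequence $C=(C_n)_{n\ge 0}$ of 2-vector spaces; its underlying category $\bigoplus_n C_n$ has as objects the families $(X_n)$ with almost all $X_n$ zero. A $k$-multilinear functor $G$ in the variables $C_1,\dots,C_r$ has *bounded degree* if there is a constant $B$ such that every degree in which $G(X_1,\dots,X_r)$ is nonzero differs by at most $B$ from a sum $n_1+\dots+n_r$ with $(X_i)_{n_i}\neq 0$; it has *degree zero* if one can take $B=0$. Let $\mathrm{FinSet}_*$ be the category of pointed finite sets. $\mathrm{FinSet}^{\sqcup}\to\mathrm{FinSet}_*$ is the category whose objects over $I$ are families $(S_i)$ of finite sets indexed by the elements $i\neq *$ of $I$; a morphism $(S_i)\to(T_j)$ over $\varphi:I\to J$ is a collection of maps $S_i\to T_{\varphi(i)}$ for all $i$ with $\varphi(i)\ne *$. $2\text{-}\mathrm{Vect}_{gr}^{\otimes}\to \mathrm{FinSet}_*$ is the bicategory whose objects over $I$ are families $(C_i)$ of graded 2-vector spaces indexed by the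 elements $i\ne *$ of $I$; a 1-morphism $(C_i)\to(D_j)$ over $\varphi$ is a collection of $k$-multilinear functors $\prod_{\varphi(i)=j}C_i\to D_j$ of bounded degree, one for each $j\neq *$; 2-morphisms are collections of natural transformations between 1-morphisms over the same $\varphi$. A 1-morphism $f:A\to B$ over $\varphi: I\to J$ is *coCartesian* if for each $Z$ over $L$ composition with $f$ gives an equivalence from $\mathrm{Hom}(B,Z)$ to the pseudo-pullback of $\mathrm{Hom}(A,Z)\to\mathrm{Hom}(I,L)\leftarrow\mathrm{Hom}(J,L)$. A square of 1-morphisms $g:A\to B$, $f:A\to C$, $h:B\to D$, $i:C\to D$ with a 2-morphism $\alpha:h g\Rightarrow i f$ satisfies the *right Beck–Chevalley condition* if its right mate $g f^R\Rightarrow h^R i$ is invertible, where $f^R,h^R$ are right adjoints of $f,h$. An *SSH category* is a pseudofunctor $\mathcal H:\mathrm{FinSet}^{\sqcup}\to 2\text{-}\mathrm{Vect}_{gr}^{\otimes}$ over $\mathrm{FinSet}_*$ (up to natural isomorphism) that takes morphisms to 1-morphisms of degree zero, takes coCartesian morphisms to coCartesian 1-morphisms, and takes Cartesian squares of finite sets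 (over $\{*,1\}$) to squares that satisfy the right Beck–Chevalley condition. **Notation.** Write $\mathbf n=\{1,\dots,n\}$, $\mathcal C=\mathcal H(\mathbf 1)$, and let $m:\mathcal H(\mathbf 2)\to\mathcal H(\mathbf 1)$ be the image of $\mathbf 2\to\mathbf 1$. Let $\bar m,\ m^2:\mathcal H(\mathbf 4)\to\mathcal H(\mathbf 2)$ be the images of the maps $\mathbf 4\to\mathbf 2$ given by $1,3\mapsto 1;\ 2,4\mapsto 2$ and by $1,2\mapsto 1;\ 3,4\mapsto 2$ respectively. Let $c:(\mathbf 1,\mathbf 1)\to\mathbf 2$ be the morphism over $\{*,1,2\}\to\{*,1\}$, $1,2\mapsto 1$, given by $1\mapsto 1$ and $1\mapsto 2$, and $\bar c:(\mathbf 2,\mathbf 2)\to\mathbf 4$ the one given by $1\mapsto1,\,2\mapsto 3$ on the first entry and $1\mapsto 2,\,2\mapsto 4$ on the second. For an object $\Phi$ of $\mathcal H(S)$, $(\Phi,\mathrm{Id}):\mathcal H(S)\to\mathcal H((S,S))$ is the 1-morphism with entries the constant functor $\Phi$ and the identity, where both entries of $\mathcal H((S,S))$ are identified with $\mathcal H(S)$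 through the images of the two maps $(S,S)\to(S)$ that forget an entry. Let $\Delta^l\dashv m\dashv\Delta^r$ and $m^2\dashv(\Delta^r)^2$. For an object $F$ of $\mathcal C$ put $i_F=\mathcal H(c)\circ(F,\mathrm{Id}):\mathcal C\to\mathcal H(\mathbf 2)$ and, for $\Phi=\Delta^l(F)$, $i_\Phi=\mathcal H(\bar c)\circ(\Phi,\mathrm{Id}):\mathcal H(\mathbf 2)\to\mathcal H(\mathbf 4)$; let $j^r_F,\ j^r_\Phi$ be their right adjoints, and put $$\Delta^r_F=j^r_F\circ\Delta^r,\qquad(\Delta^r)^2_\Phi=j^r_\Phi\circ(\Delta^r)^2 .$$ These are right adjoint to $m_F=m\circ i_F$ and $m^2_\Phi=m^2\circ i_\Phi$. **Theorem.** Let $\mathcal H$ be an SSH category and let $F$ be an object of $\mathcal C$. Then all the 1-morphisms above, including the adjoints in $2\text{-}\mathrm{Vect}_{gr}^\otimes$, exist. For every choice of them there is a unique 2-morphism $$\tau=(\eta,\mathrm{Id}):(F,\mathrm{Id})\circ m\Rightarrow(m,m)\circ(\Delta^l(F),\mathrm{Id})$$ whose first entry is the unit $\eta:F\to m\Delta^l(F)$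 and whose second entry is the identity of $m$. Let $\beta: i_F\circ m\Rightarrow\bar m\circ i_{\Delta^l(F)}$ be the pasting of $\tau$ with the image under $\mathcal H$ of the commutative square formed by $(\mathbf 2,\mathbf 2)\to(\mathbf 1,\mathbf 1)$, $\bar c$, $c$ and $\mathbf 4\to\mathbf 2$ ($1,3\mapsto1$; $2,4\mapsto2$), and let $\alpha: m_F\circ m\Rightarrow m\circ m^2_{\Delta^l(F)}$ be the pasting of $\beta$ with the image of the Cartesian square formed by the two maps $\mathbf 4\to\mathbf 2$ above and $\mathbf 2\to\mathbf 1$. Then both squares $\beta$ and $\alpha$ satisfy the right Beck–Chevalley condition. In particular the right mate $m\circ(\Delta^r)^2_{\Delta^l(F)}\Rightarrow\Delta^r_F\circ m$ of $\alpha$ is invertible, and its inverse is a canonical 2-isomorphism $$\Delta^r_F\circ m\;\cong\; m\circ(\Delta^r)^2_{\Delta^l(F)} .$$ -/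

import Mathlib

open CategoryTheory Bicategory

universe u v w

namespace SelfAdjointHopf

/-! ### Pointed finite sets -/

/-- A pointed finite set. -/
structure FinPt : Type 1 where
  carrier : Type
  [finite : Finite carrier]
  pt : carrier

namespace FinPt

attribute [instance] FinPt.finite

/-- The complement of the base point. -/
abbrev Nonbase (I : FinPt) : Type := {i : I.carrier // i ≠ I.pt}

/-- Maps of pointed sets. -/
@[ext]
structure Hom (I J : FinPt) : Type where
  toFun : I.carrier → J.carrier
  map_pt : toFun I.pt = J.pt

instance : Category FinPt where
  Hom := Hom
  id I := ⟨id, rfl⟩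
  comp f g := ⟨g.toFun ∘ f.toFun, by simp [f.map_pt, g.map_pt]⟩

@[ext]
theorem hom_ext {I J : FinPt} {f g : I ⟶ J} (h : ∀ i, f.toFun i = g.toFun i) : f = g :=
  Hom.ext (funext h)

/-- The pointed set `{*, 1, …, n}`, realized as `Fin (n + 1)` with base point `0`. -/
def std (n : ℕ) : FinPt := ⟨Fin (n + 1), 0⟩

/-- The fibre of a pointed map over an element other than the base point. -/
abbrev Fiber {I J : FinPt} (φ : I ⟶ J) (j : J.Nonbase) : Type :=
  {i : I.Nonbase // φ.toFun i.1 = j.1}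

end FinPt

/-! ### The category `FinSet^⊔` over pointed finite sets -/

/-- An object over `I`: a collection of finite sets indexed by the elements of `I` other than the
base point (the component at the base point is a one-point set and carries no information). -/
structure FinSetSqcup : Type 1 where
  base : FinPt
  fam : base.Nonbase → FintypeCat.{0}

namespace FinSetSqcup

/-- A morphism over `φ : I ⟶ J`: maps `S_i ⟶ T_{φ i}` (no information when `φ i` is the
base point). -/
@[ext]
structure Hom (X Y : FinSetSqcup) : Type where
  base : X.base ⟶ Y.base
  map : ∀ (i : X.base.Nonbase) (h : base.toFun i.1 ≠ Y.base.pt),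
    X.fam i ⟶ Y.fam ⟨base.toFun i.1, h⟩

instance : Category FinSetSqcup where
  Hom := Hom
  id X := ⟨𝟙 _, fun _ _ => 𝟙 _⟩
  comp {X Y Z} f g := ⟨f.base ≫ g.base, fun i h =>
    f.map i (fun e => h (by
      change g.base.toFun (f.base.toFun i.1) = _
      rw [e, g.base.map_pt])) ≫ g.map ⟨f.base.toFun i.1, _⟩ h⟩

/-- The projection to pointed finite sets. -/
def proj : FinSetSqcup ⥤ FinPt where
  obj X := X.base
  map f := f.base

/-- The list `(S, …, S)` of length `n`. -/
def list (n : ℕ) (S : FintypeCat.{0}) : FinSetSqcup := ⟨FinPt.std n, fun _ => S⟩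

/-- The map `(f, …, f) : (S, …, S) ⟶ (T, …, T)` over the identity. -/
def diag (n : ℕ) {S T : FintypeCat.{0}} (f : S ⟶ T) : list n S ⟶ list n T :=
  ⟨𝟙 _, fun _ _ => f⟩

/-- The map `(S, S) ⟶ (T)` over the active map `{*, 1, 2} ⟶ {*, 1}` given by two maps
`S ⟶ T`. -/
def cop {S T : FintypeCat.{0}} (f₁ f₂ : S ⟶ T) : list 2 S ⟶ list 1 T :=
  ⟨⟨(![0, 1, 1] : Fin 3 → Fin 2), rfl⟩, fun i _ => (![f₁, f₁, f₂] : Fin 3 → (S ⟶ T)) i.1⟩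

/-- The map `(S, S) ⟶ (S)` which forgets the second entry. -/
def fstEntry (S : FintypeCat.{0}) : list 2 S ⟶ list 1 S :=
  ⟨⟨(![0, 1, 0] : Fin 3 → Fin 2), rfl⟩, fun _ _ => 𝟙 S⟩

/-- The map `(S, S) ⟶ (S)` which forgets the first entry. -/
def sndEntry (S : FintypeCat.{0}) : list 2 S ⟶ list 1 S :=
  ⟨⟨(![0, 0, 1] : Fin 3 → Fin 2), rfl⟩, fun _ _ => 𝟙 S⟩

end FinSetSqcup

/-! ### Graded 2-vector spaces -/

/-- A 2-vector space over `k`: a `k`-linear category which is (`k`-linearly) equivalent to a finite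
sum of copies of the category of finite dimensional vector spaces. -/
structure TwoVect (k : Type u) [Field k] where
  carrier : Type w
  [category : Category.{v} carrier]
  [preadditive : Preadditive carrier]
  [linear : Linear k carrier]
  exists_equivalence : ∃ (n : ℕ) (e : carrier ≌ (Fin n → FGModuleCat.{u} k)),
    ∀ i, (e.functor ⋙ Pi.eval _ i).Additive ∧ (e.functor ⋙ Pi.eval _ i).Linear k

attribute [instance] TwoVect.category TwoVect.preadditive TwoVect.linear

/-- A graded 2-vector space: a sequence of 2-vector spaces. -/
abbrev TwoVectGr (k : Type u) [Field k] := ℕ → TwoVect.{u, v, w} k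

variable {k : Type u} [Field k]

/-- The underlying category `⨁ₙ Cₙ` of a graded 2-vector space: its objects are the families of
objects of the `Cₙ` almost all of which are zero. -/
structure Tot (C : TwoVectGr.{u, v, w} k) where
  obj : ∀ n, (C n).carrier
  finite : {n | ¬ Limits.IsZero (obj n)}.Finite

namespace Tot

variable {C : TwoVectGr.{u, v, w} k}

instance : Category (Tot C) where
  Hom X Y := ∀ n, X.obj n ⟶ Y.obj n
  id X n := 𝟙 (X.obj n)
  comp f g n := f n ≫ g n

instance (X Y : Tot C) : AddCommGroup (X ⟶ Y) :=
  inferInstanceAs (AddCommGroup (∀ n, X.obj n ⟶ Y.obj n))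

instance (X Y : Tot C) : Module k (X ⟶ Y) :=
  inferInstanceAs (Module k (∀ n, X.obj n ⟶ Y.obj n))

/-- The set of degrees in which an object does not vanish. -/
def supp (X : Tot C) : Set ℕ := {n | ¬ Limits.IsZero (X.obj n)}

end Tot

/-- A functor in several variables is `k`-multilinear when it is so on morphisms. -/
def IsMultilinear {ι : Type} {C : ι → TwoVectGr.{u, v, w} k} {D : TwoVectGr.{u, v, w} k}
    (G : (∀ i, Tot (C i)) ⥤ Tot D) : Prop :=
  ∀ X Y : (∀ i, Tot (C i)), ∃ M : MultilinearMap k (fun i => X i ⟶ Y i) (G.obj X ⟶ G.obj Y),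
    ∀ f : X ⟶ Y, M f = G.map f

/-- A functor in several variables has bounded degree when, for some bound `B`, every
nonvanishing degree of `G (X_i)` differs by at most `B` from a sum of nonvanishing
degrees of the `X_i`. -/
def IsBounded {ι : Type} {C : ι → TwoVectGr.{u, v, w} k} {D : TwoVectGr.{u, v, w} k}
    (G : (∀ i, Tot (C i)) ⥤ Tot D) : Prop :=
  ∃ B : ℕ, ∀ X, ∀ m ∈ (G.obj X).supp, ∃ n : ι → ℕ, (∀ i, n i ∈ (X i).supp) ∧
    |(m : ℤ) - ∑ᶠ i, (n i : ℤ)| ≤ B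

/-- A functor in several variables has degree zero when every nonvanishing degree of `G (X_i)` is
a sum of nonvanishing degrees of the `X_i`. -/
def IsDegreeZero {ι : Type} {C : ι → TwoVectGr.{u, v, w} k} {D : TwoVectGr.{u, v, w} k}
    (G : (∀ i, Tot (C i)) ⥤ Tot D) : Prop :=
  ∀ X, ∀ m ∈ (G.obj X).supp, ∃ n : ι → ℕ, (∀ i, n i ∈ (X i).supp) ∧ m = ∑ᶠ i, n i

/-- The `k`-multilinear functors of bounded degree in the variables `C i`. They are automatically
exact in each variable, as all the categories are semisimple. For an empty set of variables, this
is an object of the target. -/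
structure MultiFun {ι : Type} (C : ι → TwoVectGr.{u, v, w} k) (D : TwoVectGr.{u, v, w} k) where
  functor : (∀ i, Tot (C i)) ⥤ Tot D
  multilinear : IsMultilinear functor
  bounded : IsBounded functor

/-! ### The bicategory `2-Vect_gr^⊗` over pointed finite sets -/

/-- An object over `I`: a collection of graded 2-vector spaces indexed by the elements of `I`
other than the base point (the component at the base point is the zero category and carries no
information). -/
structure TwoVectTensor (k : Type u) [Field k] where
  base : FinPt
  fam : base.Nonbase → TwoVectGr.{u, v, w} k

namespace TwoVectTensor

/-- A 1-morphism over `φ : I ⟶ J`: functors `∏_{φ i = j} C_i ⥤ D_j` for all `j`. -/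
structure Hom (A B : TwoVectTensor.{u, v, w} k) where
  base : A.base ⟶ B.base
  comp : ∀ j : B.base.Nonbase, MultiFun (fun i : FinPt.Fiber base j => A.fam i.1) (B.fam j)

/-- For two equal maps of pointed sets, the identification of the products over their fibres. -/
abbrev reindex (A : TwoVectTensor.{u, v, w} k) {J : FinPt} {φ ψ : A.base ⟶ J} (h : φ = ψ)
    (j : J.Nonbase) :
    (∀ i : FinPt.Fiber φ j, Tot (A.fam i.1)) ⥤ (∀ i : FinPt.Fiber ψ j, Tot (A.fam i.1)) where
  obj X i := X ⟨i.1, by rw [h]; exact i.2⟩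
  map f i := f ⟨i.1, by rw [h]; exact i.2⟩

/-- A 2-morphism between 1-morphisms over the same map of pointed sets: natural transformations
between the components. -/
@[ext]
structure Hom₂ {A B : TwoVectTensor.{u, v, w} k} (F G : Hom A B) where
  base_eq : F.base = G.base
  app : ∀ j, (F.comp j).functor ⟶ reindex A base_eq j ⋙ (G.comp j).functor

theorem fiber_id_eq {I : FinPt} {j : I.Nonbase} (i : FinPt.Fiber (𝟙 I) j) : i = ⟨j, rfl⟩ :=
  Subtype.ext (Subtype.ext i.2)

/-- The identity of `A`: its components are the evaluations `∏_{i = j} A_i ⥤ A_j`. -/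
def idHom (A : TwoVectTensor.{u, v, w} k) : Hom A A where
  base := 𝟙 _
  comp j :=
    { functor :=
        { obj := fun X => X ⟨j, rfl⟩
          map := fun f => f ⟨j, rfl⟩ }
      multilinear := by
        intro X Y
        refine ⟨⟨fun f => f ⟨j, rfl⟩, ?_, ?_⟩, fun f => rfl⟩
        · intro _ f i a b
          obtain rfl := fiber_id_eq i
          simp
        · intro _ f i c a
          obtain rfl := fiber_id_eq i
          simp
      bounded := by
        refine ⟨0, fun X m hm => ⟨fun _ => m, fun i => ?_, ?_⟩⟩
        · obtain rfl := fiber_id_eq i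
          exact hm
        · let _ : Unique (FinPt.Fiber (𝟙 A.base) j) := ⟨⟨⟨j, rfl⟩⟩, fiber_id_eq⟩
          rw [finsum_unique]
          simp }

/-- The components of a composition of 1-morphisms: substitution of functors in several
variables. -/
def compFunctor {A B C : TwoVectTensor.{u, v, w} k} (F : Hom A B) (G : Hom B C)
    (l : C.base.Nonbase) :
    (∀ i : FinPt.Fiber (F.base ≫ G.base) l, Tot (A.fam i.1)) ⥤ Tot (C.fam l) where
  obj X := (G.comp l).functor.obj fun j => (F.comp j.1).functor.obj fun i =>
    X ⟨i.1, (congrArg G.base.toFun i.2).trans j.2⟩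
  map f := (G.comp l).functor.map fun j => (F.comp j.1).functor.map fun i =>
    f ⟨i.1, (congrArg G.base.toFun i.2).trans j.2⟩
  map_id X := by
    refine Eq.trans ?_ ((G.comp l).functor.map_id _)
    congr 1; funext j
    exact (F.comp j.1).functor.map_id _
  map_comp f g := by
    refine Eq.trans ?_ ((G.comp l).functor.map_comp _ _)
    congr 1; funext j
    exact (F.comp j.1).functor.map_comp _ _

theorem compFunctor_map_update {A B C : TwoVectTensor.{u, v, w} k} (F : Hom A B) (G : Hom B C)
    (l : C.base.Nonbase) [DecidableEq (FinPt.Fiber (F.base ≫ G.base) l)]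
    [DecidableEq (FinPt.Fiber G.base l)] [∀ j, DecidableEq (FinPt.Fiber F.base j)]
    {X Y : ∀ i : FinPt.Fiber (F.base ≫ G.base) l, Tot (A.fam i.1)}
    (f : ∀ i, X i ⟶ Y i) (i : FinPt.Fiber (F.base ≫ G.base) l) (j : FinPt.Fiber G.base l)
    (h : F.base.toFun i.1.1 = j.1.1) (a : X i ⟶ Y i) :
    (compFunctor F G l).map (X := X) (Y := Y) (Function.update f i a) =
      (G.comp l).functor.map (Function.update
        (fun j => (F.comp j.1).functor.map fun i =>
          f ⟨i.1, (congrArg G.base.toFun i.2).trans j.2⟩) j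
        ((F.comp j.1).functor.map (Function.update
          (fun i => f ⟨i.1, (congrArg G.base.toFun i.2).trans j.2⟩) ⟨i.1, h⟩ a))) := by
  refine congrArg (G.comp l).functor.map (funext fun j' => ?_)
  by_cases hj : j' = j
  · subst hj
    rw [Function.update_self]
    refine congrArg (F.comp j'.1).functor.map (funext fun i' => ?_)
    by_cases hi : i' = ⟨i.1, h⟩
    · subst hi
      refine (Function.update_self i a f).trans ?_
      symm
      exact Function.update_self _ _ _
    · rw [Function.update_of_ne hi]
      refine Function.update_of_ne (fun e => hi ?_) _ _
      exact Subtype.ext (congrArg (fun x : FinPt.Fiber (F.base ≫ G.base) l => x.1) e)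
  · rw [Function.update_of_ne hj]
    refine congrArg (F.comp j'.1).functor.map (funext fun i' => ?_)
    refine Function.update_of_ne (fun e => hj ?_) _ _
    have e' : i'.1 = i.1 := congrArg (fun x : FinPt.Fiber (F.base ≫ G.base) l => x.1) e
    refine Subtype.ext (Subtype.ext ?_)
    rw [← i'.2, ← h, e']

theorem compFunctor_multilinear {A B C : TwoVectTensor.{u, v, w} k} (F : Hom A B) (G : Hom B C)
    (l : C.base.Nonbase) : IsMultilinear (compFunctor F G l) := by
  classical
  intro X Y
  have key : ∀ i : FinPt.Fiber (F.base ≫ G.base) l, ∃ j : FinPt.Fiber G.base l,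
      F.base.toFun i.1.1 = j.1.1 := fun i =>
    ⟨⟨⟨F.base.toFun i.1.1, fun e => l.2
      (i.2.symm.trans ((congrArg G.base.toFun e).trans G.base.map_pt))⟩, i.2⟩, rfl⟩
  obtain ⟨M, hM⟩ := (G.comp l).multilinear
    (fun j => (F.comp j.1).functor.obj fun i => X ⟨i.1, (congrArg G.base.toFun i.2).trans j.2⟩)
    (fun j => (F.comp j.1).functor.obj fun i => Y ⟨i.1, (congrArg G.base.toFun i.2).trans j.2⟩)
  refine ⟨⟨fun f => (compFunctor F G l).map (X := X) (Y := Y) f, ?_, ?_⟩, fun f => rfl⟩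
  · intro hd f i a b
    obtain ⟨j, h⟩ := key i
    obtain ⟨N, hN⟩ := (F.comp j.1).multilinear
      (fun i => X ⟨i.1, (congrArg G.base.toFun i.2).trans j.2⟩)
      (fun i => Y ⟨i.1, (congrArg G.base.toFun i.2).trans j.2⟩)
    refine (compFunctor_map_update F G l f i j h _).trans (Eq.trans ?_ (congrArg₂ (· + ·)
      (compFunctor_map_update F G l f i j h a) (compFunctor_map_update F G l f i j h b)).symm)
    rw [← hM, ← hM, ← hM, ← hN, ← hN, ← hN, N.map_update_add, M.map_update_add]
    rfl
  · intro hd f i c a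
    obtain ⟨j, h⟩ := key i
    obtain ⟨N, hN⟩ := (F.comp j.1).multilinear
      (fun i => X ⟨i.1, (congrArg G.base.toFun i.2).trans j.2⟩)
      (fun i => Y ⟨i.1, (congrArg G.base.toFun i.2).trans j.2⟩)
    refine (compFunctor_map_update F G l f i j h _).trans (Eq.trans ?_ (congrArg (c • ·)
      (compFunctor_map_update F G l f i j h a)).symm)
    rw [← hM, ← hM, ← hN, ← hN, N.map_update_smul, M.map_update_smul]
    rfl

theorem compFunctor_bounded {A B C : TwoVectTensor.{u, v, w} k} (F : Hom A B) (G : Hom B C)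
    (l : C.base.Nonbase) : IsBounded (compFunctor F G l) := by
  classical
  obtain ⟨b, hb⟩ := (G.comp l).bounded
  choose c hc using fun j : B.base.Nonbase => (F.comp j).bounded
  have key : ∀ i : FinPt.Fiber (F.base ≫ G.base) l, F.base.toFun i.1.1 ≠ B.base.pt := fun i e =>
    l.2 (i.2.symm.trans ((congrArg G.base.toFun e).trans G.base.map_pt))
  let e : FinPt.Fiber (F.base ≫ G.base) l ≃
      Σ j : FinPt.Fiber G.base l, FinPt.Fiber F.base j.1 :=
    { toFun := fun i => ⟨⟨⟨F.base.toFun i.1.1, key i⟩, i.2⟩, ⟨i.1, rfl⟩⟩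
      invFun := fun x => ⟨x.2.1, (congrArg G.base.toFun x.2.2).trans x.1.2⟩
      left_inv := fun i => rfl
      right_inv := by
        rintro ⟨⟨⟨j, hj⟩, hl⟩, ⟨i, hi⟩⟩
        dsimp only at hi
        subst hi
        rfl }
  let _ : Fintype (FinPt.Fiber G.base l) := Fintype.ofFinite _
  let _ : ∀ j, Fintype (FinPt.Fiber F.base j) := fun j => Fintype.ofFinite _
  let _ : Fintype (FinPt.Fiber (F.base ≫ G.base) l) := Fintype.ofFinite _
  refine ⟨b + ∑ j : FinPt.Fiber G.base l, c j.1, fun X m hm => ?_⟩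
  obtain ⟨n, hn, hmn⟩ := hb _ m hm
  choose p hp hnp using fun j : FinPt.Fiber G.base l => hc j.1 _ (n j) (hn j)
  refine ⟨fun i => p (e i).1 (e i).2, fun i => hp (e i).1 (e i).2, ?_⟩
  rw [finsum_eq_sum_of_fintype] at hmn ⊢
  have h1 : ∑ i, (p (e i).1 (e i).2 : ℤ) = ∑ j, ∑ i, (p j i : ℤ) := by
    rw [Equiv.sum_comp e (fun x => (p x.1 x.2 : ℤ)), Fintype.sum_sigma]
  have h2 : |∑ j, (n j : ℤ) - ∑ j, ∑ i, (p j i : ℤ)| ≤ ∑ j : FinPt.Fiber G.base l, (c j.1 : ℤ) := by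
    rw [← Finset.sum_sub_distrib]
    refine (Finset.abs_sum_le_sum_abs _ _).trans (Finset.sum_le_sum fun j _ => ?_)
    have := hnp j
    rwa [finsum_eq_sum_of_fintype] at this
  rw [h1]
  push_cast
  calc _ = |((m : ℤ) - ∑ j, (n j : ℤ)) + (∑ j, (n j : ℤ) - ∑ j, ∑ i, (p j i : ℤ))| := by
        congr 1; ring
    _ ≤ _ := (abs_add_le _ _).trans (add_le_add hmn h2)

/-- Composition of 1-morphisms. -/
def compHom {A B C : TwoVectTensor.{u, v, w} k} (F : Hom A B) (G : Hom B C) : Hom A C where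
  base := F.base ≫ G.base
  comp l := ⟨compFunctor F G l, compFunctor_multilinear F G l, compFunctor_bounded F G l⟩

instance : CategoryStruct (TwoVectTensor.{u, v, w} k) where
  Hom := Hom
  id := idHom
  comp := compHom

instance homCategory (A B : TwoVectTensor.{u, v, w} k) : Category (A ⟶ B) where
  Hom F G := Hom₂ F G
  id F := ⟨rfl, fun j => 𝟙 _⟩
  comp α β := ⟨α.base_eq.trans β.base_eq, fun j => 
    { app := fun X => (α.app j).app X ≫ (β.app j).app ((reindex A α.base_eq j).obj X)
      naturality := fun X Y f => by
        have h1 := (α.app j).naturality f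
        have h2 := (β.app j).naturality ((reindex A α.base_eq j).map f)
        dsimp at h1 h2 ⊢
        rw [reassoc_of% h1, h2, Category.assoc] }⟩
  id_comp α := by
    refine Hom₂.ext ?_
    funext j; ext X
    exact Category.id_comp _
  comp_id α := by
    refine Hom₂.ext ?_
    funext j; ext X
    exact Category.comp_id _
  assoc α β γ := by
    refine Hom₂.ext ?_
    funext j; ext X
    exact Category.assoc _ _ _

@[ext]
theorem hom₂_ext {A B : TwoVectTensor.{u, v, w} k} {F G : A ⟶ B} {α β : F ⟶ G}
    (h : ∀ j X, (α.app j).app X = (β.app j).app X) : α = β := by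
  refine Hom₂.ext ?_
  funext j; ext X; exact h j X

/-- A 2-isomorphism given by the equality of the underlying maps and isomorphisms of components. -/
def isoMk {A B : TwoVectTensor.{u, v, w} k} {F G : A ⟶ B} (h : F.base = G.base)
    (e : ∀ j, (F.comp j).functor ≅ reindex A h j ⋙ (G.comp j).functor) : F ≅ G where
  hom := ⟨h, fun j => (e j).hom⟩
  inv := ⟨h.symm, fun j => 
    { app := fun X => (e j).inv.app ((reindex A h.symm j).obj X)
      naturality := fun X Y f => (e j).inv.naturality ((reindex A h.symm j).map f) }⟩
  hom_inv_id := by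
    ext j X : 2
    exact (e j).hom_inv_id_app X
  inv_hom_id := by
    ext j X : 2
    exact (e j).inv_hom_id_app ((reindex A h.symm j).obj X)

instance : Bicategory (TwoVectTensor.{u, v, w} k) where
  homCategory := homCategory
  whiskerLeft {A B C} F {G G'} η := ⟨congrArg (F.base ≫ ·) η.base_eq, fun l =>
    { app := fun X => (η.app l).app fun j => (F.comp j.1).functor.obj fun i =>
        X ⟨i.1, (congrArg G.base.toFun i.2).trans j.2⟩
      naturality := fun X Y f => (η.app l).naturality (fun j => (F.comp j.1).functor.map fun i =>
        f ⟨i.1, (congrArg G.base.toFun i.2).trans j.2⟩) }⟩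
  whiskerRight {A B C} {F F'} η G := ⟨congrArg (· ≫ G.base) η.base_eq, fun l =>
    { app := fun X => (G.comp l).functor.map fun j => (η.app j.1).app fun i =>
        X ⟨i.1, (congrArg G.base.toFun i.2).trans j.2⟩
      naturality := fun X Y f => by
        refine ((G.comp l).functor.map_comp _ _).symm.trans
          (Eq.trans ?_ ((G.comp l).functor.map_comp _ _))
        congr 1; funext j
        exact (η.app j.1).naturality fun i =>
          f ⟨i.1, (congrArg G.base.toFun i.2).trans j.2⟩ }⟩
  associator F G K := isoMk rfl fun l => Iso.refl _
  leftUnitor F := isoMk rfl fun l => Iso.refl _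
  rightUnitor F := isoMk rfl fun l => Iso.refl _
  whiskerLeft_id := by
    intros
    ext l X : 2
    rfl
  whiskerLeft_comp := by
    intros
    ext l X : 2
    rfl
  id_whiskerLeft := by
    intros
    ext l X : 2
    exact ((Category.id_comp _).trans (Category.comp_id _)).symm
  comp_whiskerLeft := by
    intros
    ext l X : 2
    exact ((Category.id_comp _).trans (Category.comp_id _)).symm
  id_whiskerRight F G := by
    ext l X : 2
    exact (G.comp l).functor.map_id _
  comp_whiskerRight η θ G := by
    ext l X : 2
    exact (G.comp l).functor.map_comp _ _
  whiskerRight_id := by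
    intros
    ext l X : 2
    exact ((Category.id_comp _).trans (Category.comp_id _)).symm
  whiskerRight_comp := by
    intros
    ext l X : 2
    exact ((Category.id_comp _).trans (Category.comp_id _)).symm
  whisker_assoc := by
    intros
    ext l X : 2
    exact ((Category.id_comp _).trans (Category.comp_id _)).symm
  whisker_exchange := by
    intro A B C F F' G G' η θ
    ext l X : 2
    exact ((θ.app l).naturality fun j => (η.app j.1).app fun i =>
      X ⟨i.1, (congrArg G.base.toFun i.2).trans j.2⟩).symm
  pentagon F G K L := by
    ext l X : 2
    refine congrArg (· ≫ _) ?_ |>.trans (congrArg (𝟙 _ ≫ ·) (Category.comp_id _))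
    exact (L.comp l).functor.map_id _
  triangle F G := by
    ext l X : 2
    exact (Category.comp_id _).trans ((G.comp l).functor.map_id _).symm

/-! ### CoCartesian 1-morphisms -/

/-- The projection to pointed finite sets, on categories of 1-morphisms. -/
def projHom (A B : TwoVectTensor.{u, v, w} k) : (A ⟶ B) ⥤ Discrete (A.base ⟶ B.base) where
  obj F := ⟨F.base⟩
  map α := Discrete.eqToHom α.base_eq

/-- Precomposition with a map of pointed finite sets. -/
def precompBase {I J : FinPt} (φ : I ⟶ J) (L : FinPt) : Discrete (J ⟶ L) ⥤ Discrete (I ⟶ L) :=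
  Discrete.functor fun ψ => ⟨φ ≫ ψ⟩

/-- The comparison functor from the category of 1-morphisms `B ⟶ Z` to the pseudo pullback
of the categories of 1-morphisms `A ⟶ Z` and of maps of pointed sets from the base
of `B` to the base of `Z`, over the maps from the base of `A` to the base of `Z`. -/
def comparison {A B : TwoVectTensor.{u, v, w} k} (F : A ⟶ B) (Z : TwoVectTensor.{u, v, w} k) :
    (B ⟶ Z) ⥤ Limits.CategoricalPullback (projHom A Z) (precompBase F.base Z.base) where
  obj G := ⟨F ≫ G, ⟨G.base⟩, Iso.refl _⟩
  map α := ⟨F ◁ α, Discrete.eqToHom α.base_eq, Subsingleton.elim _ _⟩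

/-- `F` is a coCartesian lift of its image in pointed finite sets. -/
def IsCoCartesian {A B : TwoVectTensor.{u, v, w} k} (F : A ⟶ B) : Prop :=
  ∀ Z : TwoVectTensor.{u, v, w} k, (comparison F Z).IsEquivalence

/-! ### The empty list, and objects as 1-morphisms out of it -/

/-- The empty list. -/
def nil : TwoVectTensor.{u, v, w} k :=
  ⟨FinPt.std 0, fun i => (i.2 (Subsingleton.elim (α := Fin 1) _ _)).elim⟩

theorem nil_false (j : (nil : TwoVectTensor.{u, v, w} k).base.Nonbase) : False :=
  j.2 (Subsingleton.elim (α := Fin 1) _ _)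

/-- The 1-morphism from a list to the empty list. -/
def toNil (A : TwoVectTensor.{u, v, w} k) : A ⟶ nil :=
  Hom.mk (B := nil) ⟨fun _ => nil.base.pt, rfl⟩ fun j => (nil_false j).elim

/-- Any two 1-morphisms to the empty list are uniquely isomorphic. -/
def toNilIso {A B : TwoVectTensor.{u, v, w} k} (F : A ⟶ B) : F ≫ toNil B ≅ toNil A :=
  isoMk rfl fun j => (nil_false j).elim

/-- The 1-morphism from the empty list given by a collection of objects. -/
def point (A : TwoVectTensor.{u, v, w} k) (X : ∀ j, Tot (A.fam j)) : nil ⟶ A :=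
  Hom.mk (A := nil) ⟨fun _ => A.base.pt, rfl⟩ fun j =>
    { functor := (Functor.const _).obj (X j)
      multilinear := fun Y Z => by
        have : IsEmpty (FinPt.Fiber (I := (nil : TwoVectTensor.{u, v, w} k).base)
          ⟨fun _ => A.base.pt, rfl⟩ j) := ⟨fun i => nil_false i.1⟩
        exact ⟨MultilinearMap.constOfIsEmpty k _ (𝟙 (X j)), fun f => rfl⟩
      bounded := by
        have : IsEmpty (FinPt.Fiber (I := (nil : TwoVectTensor.{u, v, w} k).base)
          ⟨fun _ => A.base.pt, rfl⟩ j) := ⟨fun i => nil_false i.1⟩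
        obtain ⟨B, hB⟩ := (X j).finite.bddAbove
        refine ⟨B, fun Y m hm => ⟨fun _ => 0, fun i => isEmptyElim i, ?_⟩⟩
        have h : m ≤ B := hB hm
        simpa using h }

end TwoVectTensor

/-! ### The Beck–Chevalley condition -/

/-- A square
```
A --g--> B
|f       |h
v        v
C --i--> D
```
with a 2-morphism `α : g ≫ h ⟶ f ≫ i` satisfies the (right) Beck–Chevalley condition if its right
mate `f_R ≫ g ⟶ i ≫ h_R` is invertible, for right adjoints `f_R`, `h_R` of `f`, `h`. -/
def RightBeckChevalley {𝒞 : Type*} [Bicategory 𝒞] {A B C D : 𝒞} {g : A ⟶ B} {f : A ⟶ C}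
    {h : B ⟶ D} {i : C ⟶ D} (α : g ≫ h ⟶ f ≫ i) : Prop :=
  ∀ (fR : C ⟶ A) (hR : D ⟶ B) (adjf : Bicategory.Adjunction f fR)
    (adjh : Bicategory.Adjunction h hR), IsIso (mateEquiv adjf adjh α)

/-! ### Symmetric self-adjoint Hopf categories -/

open FinSetSqcup in
/-- A symmetric self-adjoint Hopf category: a morphism `H` of fibrations over pointed finite sets
from `FinSet^⊔` to `2-Vect_gr^⊗`, which takes morphisms to 1-morphisms of degree zero, is
coCartesian, and takes Cartesian squares in the fibre over `{*, 1}` to squares that satisfy the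
Beck–Chevalley condition. -/
structure SSH (k : Type u) [Field k] where
  H : Pseudofunctor (LocallyDiscrete FinSetSqcup) (TwoVectTensor.{u, v, w} k)
  baseIso : ∀ X : FinSetSqcup, (H.obj ⟨X⟩).base ≅ X.base
  baseIso_naturality : ∀ {X Y : FinSetSqcup} (f : X ⟶ Y),
    (H.map f.toLoc).base ≫ (baseIso Y).hom = (baseIso X).hom ≫ f.base
  degreeZero : ∀ {X Y : FinSetSqcup} (f : X ⟶ Y) (j : (H.obj ⟨Y⟩).base.Nonbase),
    IsDegreeZero ((H.map f.toLoc).comp j).functor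
  coCartesian : ∀ {X Y : FinSetSqcup} (f : X ⟶ Y), proj.IsStronglyCocartesian f.base f →
    TwoVectTensor.IsCoCartesian (H.map f.toLoc)
  beckChevalley : ∀ {S T R U : FintypeCat.{0}} {a : S ⟶ T} {c : S ⟶ R} {b : T ⟶ U} {d : R ⟶ U}
    (_ : IsPullback a c b d)
    (sq : CommSq (diag 1 a) (diag 1 c) (diag 1 b) (diag 1 d)),
    RightBeckChevalley (H.isoMapOfCommSq sq.toLoc).hom

namespace SSH

open FinSetSqcup TwoVectTensor

/-- The set `{1, …, n}`, realized as `{0, …, n - 1}`. -/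
abbrev fset (n : ℕ) : FintypeCat.{0} := FintypeCat.of (Fin n)

/-- The map `{1, 2} ⟶ {1}`. -/
def fold : fset 2 ⟶ fset 1 := FintypeCat.homMk fun _ => 0

/-- The map `1 ↦ 1, 2 ↦ 2, 3 ↦ 1, 4 ↦ 2`. -/
def foldBar : fset 4 ⟶ fset 2 := FintypeCat.homMk (![0, 1, 0, 1] : Fin 4 → Fin 2)

/-- The map `1 ↦ 1, 2 ↦ 1, 3 ↦ 2, 4 ↦ 2`. -/
def foldSq : fset 4 ⟶ fset 2 := FintypeCat.homMk (![0, 0, 1, 1] : Fin 4 → Fin 2)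

/-- The morphism `({1}, {2}) ⟶ {1, 2}`. -/
def c : list 2 (fset 1) ⟶ list 1 (fset 2) :=
  cop (FintypeCat.homMk fun _ => (0 : Fin 2)) (FintypeCat.homMk fun _ => (1 : Fin 2))

/-- The morphism `({1, 2}, {1, 2}) ⟶ {1, 2, 3, 4}` given by `1 ↦ 1, 2 ↦ 3` and `1 ↦ 2, 2 ↦ 4`. -/
def cBar : list 2 (fset 2) ⟶ list 1 (fset 4) :=
  cop (FintypeCat.homMk (![0, 2] : Fin 2 → Fin 4)) (FintypeCat.homMk (![1, 3] : Fin 2 → Fin 4))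

theorem commSq_c : CommSq (diag 2 fold) cBar c (diag 1 foldBar) := by
  refine ⟨Hom.ext rfl (heq_of_eq ?_)⟩
  funext i h
  obtain ⟨i, hi⟩ := i
  change Fin 3 at i
  fin_cases i
  · exact (hi rfl).elim
  all_goals
    refine FintypeCat.hom_ext _ _ fun x => ?_
    change Fin 2 at x
    fin_cases x <;> rfl

theorem commSq_fold : CommSq (diag 1 foldBar) (diag 1 foldSq) (diag 1 fold) (diag 1 fold) :=
  ⟨rfl⟩

theorem commSq_fstEntry {S T : FintypeCat.{0}} (f : S ⟶ T) :
    CommSq (diag 2 f) (fstEntry S) (fstEntry T) (diag 1 f) :=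
  ⟨rfl⟩

theorem commSq_sndEntry {S T : FintypeCat.{0}} (f : S ⟶ T) :
    CommSq (diag 2 f) (sndEntry S) (sndEntry T) (diag 1 f) :=
  ⟨rfl⟩

variable (𝓗 : SSH.{u, v, w} k)

/-- The image under `𝓗` of the list `(S, …, S)`. -/
abbrev ob (n : ℕ) (S : FintypeCat.{0}) : TwoVectTensor.{u, v, w} k := 𝓗.H.obj ⟨list n S⟩

/-- The only element of the base of `𝓗(S)` other than the base point. -/
def one (S : FintypeCat.{0}) : (𝓗.ob 1 S).base.Nonbase :=
  ⟨(𝓗.baseIso (list 1 S)).inv.toFun (1 : Fin 2), fun h => by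
    have h1 := congrArg (fun f => f.toFun (1 : Fin 2)) (𝓗.baseIso (list 1 S)).inv_hom_id
    change (𝓗.baseIso (list 1 S)).hom.toFun ((𝓗.baseIso (list 1 S)).inv.toFun (1 : Fin 2)) =
      (1 : Fin 2) at h1
    rw [h, (𝓗.baseIso (list 1 S)).hom.map_pt] at h1
    exact absurd h1 (by change ¬ ((0 : Fin 2) = 1); decide)⟩

theorem eq_one (S : FintypeCat.{0}) (j : (𝓗.ob 1 S).base.Nonbase) : j = 𝓗.one S := by
  have h1 := congrArg (fun f => f.toFun j.1) (𝓗.baseIso (list 1 S)).hom_inv_id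
  change (𝓗.baseIso (list 1 S)).inv.toFun ((𝓗.baseIso (list 1 S)).hom.toFun j.1) = j.1 at h1
  refine Subtype.ext (h1.symm.trans (congrArg _ ?_))
  have h2 : ((𝓗.baseIso (list 1 S)).hom.toFun j.1 : Fin 2) ≠ (0 : Fin 2) := fun e => j.2 (by
    rw [← h1]
    exact (congrArg (𝓗.baseIso (list 1 S)).inv.toFun e).trans (𝓗.baseIso (list 1 S)).inv.map_pt)
  exact (Fin.eq_one_of_ne_zero _ h2)

/-- The graded 2-vector space `𝓗(S)`. -/
abbrev cat (S : FintypeCat.{0}) : TwoVectGr.{u, v, w} k := (𝓗.ob 1 S).fam (𝓗.one S)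

/-- The category `𝒞` on which `𝓗` gives a structure of self-adjoint Hopf category. -/
abbrev C : TwoVectGr.{u, v, w} k := 𝓗.cat (fset 1)

/-- An object of `𝓗(S)`, as a 1-morphism from the empty list. -/
def pt {S : FintypeCat.{0}} (X : Tot (𝓗.cat S)) : nil ⟶ 𝓗.ob 1 S :=
  point _ fun j => (𝓗.eq_one S j).symm ▸ X

/-- The multiplication `m : 𝒞^{⊗2} ⟶ 𝒞`. -/
abbrev m : 𝓗.ob 1 (fset 2) ⟶ 𝓗.ob 1 (fset 1) := 𝓗.H.map (diag 1 fold).toLoc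

/-- The 1-morphism `m̄ : 𝒞^{⊗4} ⟶ 𝒞^{⊗2}`. -/
abbrev mBar : 𝓗.ob 1 (fset 4) ⟶ 𝓗.ob 1 (fset 2) := 𝓗.H.map (diag 1 foldBar).toLoc

/-- The 1-morphism `m² : 𝒞^{⊗4} ⟶ 𝒞^{⊗2}`. -/
abbrev mSq : 𝓗.ob 1 (fset 4) ⟶ 𝓗.ob 1 (fset 2) := 𝓗.H.map (diag 1 foldSq).toLoc

/-- The 1-morphism `(m, m) : (𝒞^{⊗2}, 𝒞^{⊗2}) ⟶ (𝒞, 𝒞)`. -/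
abbrev mm : 𝓗.ob 2 (fset 2) ⟶ 𝓗.ob 2 (fset 1) := 𝓗.H.map (diag 2 fold).toLoc

/-- For an object `Φ` of `𝓗(S)`, the 1-morphism `(Φ, Id) : 𝓗(S) ⟶ 𝓗((S, S))`, with the
identifications of its two entries. As `𝓗` is only defined up to equivalence, the entries of the
list `𝓗((S, S))` are identified with `𝓗(S)` through the images of the two maps
`(S, S) ⟶ (S)`. -/
structure Insertion {S : FintypeCat.{0}} (Φ : nil ⟶ 𝓗.ob 1 S) where
  hom : 𝓗.ob 1 S ⟶ 𝓗.ob 2 S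
  fst : hom ≫ 𝓗.H.map (fstEntry S).toLoc ≅ toNil _ ≫ Φ
  snd : hom ≫ 𝓗.H.map (sndEntry S).toLoc ≅ 𝟙 _

/-- The adjoints `Δˡ ⊣ m ⊣ Δʳ` and `m² ⊣ (Δʳ)²`, the 1-morphisms `i_F = 𝓗(c) ∘ (F, Id)` and
`i_{Δˡ(F)} = 𝓗(c̄) ∘ (Δˡ(F), Id)`, and their right adjoints `jʳ_F` and `jʳ_{Δˡ(F)}`. All of
these are unique up to canonical isomorphism. -/
structure HeisenbergData (F : Tot 𝓗.C) where
  Δl : 𝓗.ob 1 (fset 1) ⟶ 𝓗.ob 1 (fset 2)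
  adjl : Bicategory.Adjunction Δl 𝓗.m
  Δr : 𝓗.ob 1 (fset 1) ⟶ 𝓗.ob 1 (fset 2)
  adjr : Bicategory.Adjunction 𝓗.m Δr
  ΔrSq : 𝓗.ob 1 (fset 2) ⟶ 𝓗.ob 1 (fset 4)
  adjrSq : Bicategory.Adjunction 𝓗.mSq ΔrSq
  ins : 𝓗.Insertion (𝓗.pt F)
  insΔ : 𝓗.Insertion (𝓗.pt F ≫ Δl)
  j : 𝓗.ob 1 (fset 2) ⟶ 𝓗.ob 1 (fset 1)
  adjj : Bicategory.Adjunction (ins.hom ≫ 𝓗.H.map c.toLoc) j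
  jΔ : 𝓗.ob 1 (fset 4) ⟶ 𝓗.ob 1 (fset 2)
  adjjΔ : Bicategory.Adjunction (insΔ.hom ≫ 𝓗.H.map cBar.toLoc) jΔ

namespace HeisenbergData

variable {𝓗} {F : Tot 𝓗.C} (D : 𝓗.HeisenbergData F)

/-- `i_F : 𝒞 ⟶ 𝒞^{⊗2}`, `X ↦ F ⊠ X`. -/
abbrev i : 𝓗.ob 1 (fset 1) ⟶ 𝓗.ob 1 (fset 2) := D.ins.hom ≫ 𝓗.H.map c.toLoc

/-- `i_Φ : 𝒞^{⊗2} ⟶ 𝒞^{⊗4}`, `X ↦ 𝓗(c̄)(Φ, X)`, for `Φ = Δˡ(F)`. -/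
abbrev iΔ : 𝓗.ob 1 (fset 2) ⟶ 𝓗.ob 1 (fset 4) := D.insΔ.hom ≫ 𝓗.H.map cBar.toLoc

/-- `m_F = m ∘ i_F`. -/
abbrev mF : 𝓗.ob 1 (fset 1) ⟶ 𝓗.ob 1 (fset 1) := D.i ≫ 𝓗.m

/-- `m²_Φ = m² ∘ i_Φ` for `Φ = Δˡ(F)`. -/
abbrev mSqΔ : 𝓗.ob 1 (fset 2) ⟶ 𝓗.ob 1 (fset 2) := D.iΔ ≫ 𝓗.mSq

/-- `Δʳ_F = jʳ_F ∘ Δʳ`. -/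
abbrev ΔrF : 𝓗.ob 1 (fset 1) ⟶ 𝓗.ob 1 (fset 1) := D.Δr ≫ D.j

/-- `(Δʳ)²_Φ = jʳ_Φ ∘ (Δʳ)²` for `Φ = Δˡ(F)`. -/
abbrev ΔrSqΔ : 𝓗.ob 1 (fset 2) ⟶ 𝓗.ob 1 (fset 2) := D.ΔrSq ≫ D.jΔ

/-- The condition that `τ : (F, Id) ∘ m ⟶ (m, m) ∘ (Δˡ(F), Id)` is the 2-morphism `(η, Id)`: on the
first entry it is the unit `η : F ⟶ m Δˡ(F)`, on the second entry it is the identity of `m`. -/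
def IsUnitSquare (τ : 𝓗.m ≫ D.ins.hom ⟶ D.insΔ.hom ≫ 𝓗.mm) : Prop :=
  (τ ▷ 𝓗.H.map (fstEntry (fset 1)).toLoc ⊗≫
      D.insΔ.hom ◁ (𝓗.H.isoMapOfCommSq (commSq_fstEntry fold).toLoc).hom ⊗≫
      D.insΔ.fst.hom ▷ 𝓗.m =
    𝟙 _ ⊗≫ 𝓗.m ◁ D.ins.fst.hom ⊗≫ (toNilIso 𝓗.m).hom ▷ 𝓗.pt F ⊗≫
      (toNil _ ≫ 𝓗.pt F) ◁ D.adjl.unit ⊗≫ 𝟙 _) ∧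
  (τ ▷ 𝓗.H.map (sndEntry (fset 1)).toLoc ⊗≫
      D.insΔ.hom ◁ (𝓗.H.isoMapOfCommSq (commSq_sndEntry fold).toLoc).hom ⊗≫
      D.insΔ.snd.hom ▷ 𝓗.m =
    𝟙 _ ⊗≫ 𝓗.m ◁ D.ins.snd.hom ⊗≫ 𝟙 _)

/-- The square `β`: the pasting of a 2-morphism `τ` with the image of the Cartesian square
`((2, 2), (1, 1), 4, 2)`. -/
def β (τ : 𝓗.m ≫ D.ins.hom ⟶ D.insΔ.hom ≫ 𝓗.mm) : 𝓗.m ≫ D.i ⟶ D.iΔ ≫ 𝓗.mBar :=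
  𝟙 _ ⊗≫ τ ▷ 𝓗.H.map c.toLoc ⊗≫
    D.insΔ.hom ◁ (𝓗.H.isoMapOfCommSq commSq_c.toLoc).hom ⊗≫ 𝟙 _

/-- The square `α`: the pasting of `β` with the image of the Cartesian square `(4, 2, 2, 1)` of
finite sets. -/
def α (τ : 𝓗.m ≫ D.ins.hom ⟶ D.insΔ.hom ≫ 𝓗.mm) : 𝓗.m ≫ D.mF ⟶ D.mSqΔ ≫ 𝓗.m :=
  𝟙 _ ⊗≫ D.β τ ▷ 𝓗.m ⊗≫ D.iΔ ◁ (𝓗.H.isoMapOfCommSq commSq_fold.toLoc).hom ⊗≫ 𝟙 _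

/-- The right mate of `α` for the adjunctions `m²_Φ ⊣ (Δʳ)²_Φ` and `m_F ⊣ Δʳ_F`. -/
def mate (τ : 𝓗.m ≫ D.ins.hom ⟶ D.insΔ.hom ≫ 𝓗.mm) : D.ΔrSqΔ ≫ 𝓗.m ⟶ 𝓗.m ≫ D.ΔrF :=
  mateEquiv (D.adjjΔ.comp D.adjrSq) (D.adjj.comp D.adjr) (D.α τ)

end HeisenbergData

end SSH

end SelfAdjointHopf

/-!
The left mate of `τ = (η, Id)` is invertible because its two entries are: one is the left mate of
the unit `η`, the other that of an identity. Restriction along a coCartesian 1-morphism is fully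
faithful, so pasting with the images of the coCartesian `c` and `c̄` preserves invertibility of
left mates. For a square whose 1-morphisms have both adjoints the left mate is invertible iff the
right mate is, which gives the Beck–Chevalley condition for `β`; pasting with the Cartesian square
gives it for `α`. The adjoints exist because the totalizations are semisimple with finitely many
simple objects in each degree, and all 1-morphisms involved lie over bijections, where they amount
to linear functors of one variable and bounded degree.
-/

namespace SelfAdjointHopf

/-! ### Mates in a bicategory -/

section Mates

variable {𝒞 : Type*} [Bicategory 𝒞] {a b c d : 𝒞}

theorem homEquiv₁_whiskerLeft_comp_leftMate {l₁ : a ⟶ b} {r₁ : b ⟶ a} (adj₁ : l₁ ⊣ r₁)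
    {l₂ : c ⟶ d} {r₂ : d ⟶ c} (adj₂ : l₂ ⊣ r₂) {g : a ⟶ c} {h : b ⟶ d}
    (σ : r₁ ≫ g ⟶ h ≫ r₂) {x : c ⟶ d} (f : x ⟶ l₂) :
    adj₁.homEquiv₁ (g ◁ f ≫ (mateEquiv adj₁ adj₂).symm σ) =
      (α_ _ _ _).inv ≫ σ ▷ x ≫ (α_ _ _ _).hom ≫
        h ◁ (r₂ ◁ f ≫ adj₂.counit) ≫ (ρ_ h).hom := by
  have mate_eq : (mateEquiv adj₁ adj₂).symm σ =
      adj₁.homEquiv₁.symm ((α_ _ _ _).inv ≫ adj₂.homEquiv₂.symm σ) := by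
    rw [mateEquiv_symm_apply', Adjunction.homEquiv₁_symm_apply, Adjunction.homEquiv₂_symm_apply]
    bicategory
  have homEquiv₁_naturality (y : g ≫ l₂ ⟶ l₁ ≫ h) :
      adj₁.homEquiv₁ (g ◁ f ≫ y) = r₁ ◁ g ◁ f ≫ adj₁.homEquiv₁ y := by
    simp only [Adjunction.homEquiv₁_apply, whiskerLeft_comp, Category.assoc]
  rw [homEquiv₁_naturality, mate_eq, Equiv.apply_symm_apply, Adjunction.homEquiv₂_symm_apply]
  calc
    _ = (α_ _ _ _).inv ≫ ((r₁ ≫ g) ◁ f ≫ σ ▷ l₂) ≫ (α_ _ _ _).hom ≫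
        h ◁ adj₂.counit ≫ (ρ_ h).hom := by bicategory
    _ = _ := by
      rw [whisker_exchange]
      bicategory

theorem bijective_whiskerLeft_comp_leftMate {l₁ : a ⟶ b} {r₁ : b ⟶ a} (adj₁ : l₁ ⊣ r₁)
    {l₂ : c ⟶ d} {r₂ : d ⟶ c} (adj₂ : l₂ ⊣ r₂) {g : a ⟶ c} {h : b ⟶ d}
    (σ : r₁ ≫ g ⟶ h ≫ r₂) [IsIso σ] [(precomp d h).Full] [(precomp d h).Faithful] (x : c ⟶ d) :
    Function.Bijective fun f : x ⟶ l₂ => g ◁ f ≫ (mateEquiv adj₁ adj₂).symm σ := by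
  let e₁ : (x ⟶ l₂) ≃ (r₂ ≫ x ⟶ 𝟙 d) :=
    (Iso.homCongr (Iso.refl x) (ρ_ l₂).symm).trans adj₂.homEquiv₁
  let e₂ : (h ≫ r₂ ≫ x ⟶ h ≫ 𝟙 d) ≃ (g ≫ x ⟶ l₁ ≫ h) :=
    (Iso.homCongr (asIso ((α_ r₁ g x).inv ≫ σ ▷ x ≫ (α_ h r₂ x).hom)).symm (ρ_ h)).trans
      adj₁.homEquiv₁.symm
  have he₁ (f : x ⟶ l₂) : e₁ f = r₂ ◁ f ≫ adj₂.counit := by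
    simp [e₁, Adjunction.homEquiv₁_apply]
  have whiskerLeft_bijective : Function.Bijective fun f : r₂ ≫ x ⟶ 𝟙 d => h ◁ f :=
    Functor.FullyFaithful.map_bijective (.ofFullyFaithful (precomp d h)) _ _
  convert e₂.bijective.comp (whiskerLeft_bijective.comp e₁.bijective) using 1
  funext f
  refine adj₁.homEquiv₁.injective ?_
  rw [homEquiv₁_whiskerLeft_comp_leftMate]
  simp [e₂, he₁]

theorem isIso_of_bijective_map_comp {𝒳 𝒴 : Type*} [Category 𝒳] [Category 𝒴] {Q : 𝒳 ⥤ 𝒴}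
    [Q.Full] [Q.Faithful] {y : 𝒳} {z : 𝒴} (t : Q.obj y ⟶ z) (hz : Q.essImage z)
    (ht : ∀ x, Function.Bijective fun f : x ⟶ y => Q.map f ≫ t) : IsIso t := by
  obtain ⟨z', ⟨θ⟩⟩ := hz
  obtain ⟨t', ht'⟩ := Q.map_surjective (t ≫ θ.inv)
  have : IsIso t' := by
    refine (isIso_iff_yoneda_map_bijective t').2 fun x => ?_
    have hQ : Function.Bijective (Q.map : (x ⟶ z') → _) :=
      Functor.FullyFaithful.map_bijective (.ofFullyFaithful Q) _ _
    rw [← hQ.of_comp_iff']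
    convert ((Iso.homCongr (.refl (Q.obj x)) θ.symm).bijective).comp (ht x) using 1
    funext f
    simp [ht']
  rw [← Category.comp_id t, ← θ.inv_hom_id, ← Category.assoc, ← ht']
  infer_instance

/-- Testing against all `x : c ⟶ d`, the left mate is a couniversal 2-morphism from a 1-morphism in
the image of precomposition with `q`, which is fully faithful. -/
theorem isIso_leftMate_of_fullyFaithful_precomp {L : a ⟶ b} {R : b ⟶ a} (adj : L ⊣ R)
    {L' : c ⟶ d} {R' : d ⟶ c} (adj' : L' ⊣ R') {q : a ⟶ c} {p : b ⟶ d}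
    (σ : R ≫ q ⟶ p ≫ R') [IsIso σ] [(precomp d q).Full] [(precomp d q).Faithful]
    [(precomp d p).Full] [(precomp d p).Faithful] (h : (precomp d q).essImage (L ≫ p)) :
    IsIso ((mateEquiv adj adj').symm σ) :=
  isIso_of_bijective_map_comp (Q := precomp d q) _ h
    (bijective_whiskerLeft_comp_leftMate adj adj' σ)

section Pasting

variable {e f : 𝒞} {g₁ : a ⟶ c} {g₂ : c ⟶ e} {h₁ : b ⟶ d} {h₂ : d ⟶ f}
  {l₁ : a ⟶ b} {r₁ : b ⟶ a} {l₂ : c ⟶ d} {r₂ : d ⟶ c} {l₃ : e ⟶ f} {r₃ : f ⟶ e}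

theorem leftMate_vcomp (adj₁ : l₁ ⊣ r₁) (adj₂ : l₂ ⊣ r₂) (adj₃ : l₃ ⊣ r₃)
    (σ : r₁ ≫ g₁ ⟶ h₁ ≫ r₂) (τ : r₂ ≫ g₂ ⟶ h₂ ≫ r₃) :
    (mateEquiv adj₁ adj₃).symm (rightAdjointSquare.vcomp σ τ) =
      leftAdjointSquare.vcomp ((mateEquiv adj₁ adj₂).symm σ) ((mateEquiv adj₂ adj₃).symm τ) := by
  rw [Equiv.symm_apply_eq, mateEquiv_vcomp adj₁ adj₂ adj₃, Equiv.apply_symm_apply,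
    Equiv.apply_symm_apply]

theorem isIso_whiskerRight_leftMate (adj₁ : l₁ ⊣ r₁) (adj₂ : l₂ ⊣ r₂) (adj₃ : l₃ ⊣ r₃)
    (σ : r₁ ≫ g₁ ⟶ h₁ ≫ r₂) (τ : r₂ ≫ g₂ ⟶ h₂ ≫ r₃)
    (hτ : IsIso ((mateEquiv adj₂ adj₃).symm τ))
    (hστ : IsIso ((mateEquiv adj₁ adj₃).symm (rightAdjointSquare.vcomp σ τ))) :
    IsIso ((mateEquiv adj₁ adj₂).symm σ ▷ h₂) := by
  rw [leftMate_vcomp adj₁ adj₂ adj₃, leftAdjointSquare.vcomp] at hστ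
  simpa only [isIso_comp_left_iff, isIso_comp_right_iff] using hστ

theorem pasting_eq_iff (σ : r₂ ≫ g₂ ≅ h₂ ≫ r₃) {h : b ⟶ f} (v : h₁ ≫ h₂ ≅ h)
    (τ : (r₁ ≫ g₁) ≫ g₂ ⟶ (h₁ ≫ r₂) ≫ g₂) (ρ : (r₁ ≫ g₁) ≫ g₂ ⟶ h ≫ r₃) :
    τ ⊗≫ h₁ ◁ σ.hom ⊗≫ v.hom ▷ r₃ = ρ ↔
      τ = ρ ≫ v.inv ▷ r₃ ≫ (α_ _ _ _).hom ≫ h₁ ◁ σ.inv ≫ (α_ _ _ _).inv := by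
  have pasting_eq : τ ⊗≫ h₁ ◁ σ.hom ⊗≫ v.hom ▷ r₃ =
      τ ≫ (α_ _ _ _ ≪≫ whiskerLeftIso h₁ σ ≪≫ (α_ _ _ _).symm ≪≫ whiskerRightIso v r₃).hom := by
    simp [bicategoricalComp]
  rw [pasting_eq, ← Iso.eq_comp_inv]
  simp

theorem vcomp_eq_of_pasting_eq (σ : r₂ ≫ g₂ ⟶ h₂ ≫ r₃) {h : b ⟶ f} (v : h₁ ≫ h₂ ≅ h)
    (τ : r₁ ≫ g₁ ⟶ h₁ ≫ r₂) {g : a ⟶ e} (u : g₁ ≫ g₂ ⟶ g) (ρ : r₁ ≫ g ⟶ h ≫ r₃)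
    (H : τ ▷ g₂ ⊗≫ h₁ ◁ σ ⊗≫ v.hom ▷ r₃ = 𝟙 _ ⊗≫ r₁ ◁ u ⊗≫ ρ) :
    rightAdjointSquare.vcomp τ σ = r₁ ◁ u ≫ ρ ≫ v.inv ▷ r₃ := by
  calc
    _ = (𝟙 (r₁ ≫ g₁ ≫ g₂) ⊗≫ (τ ▷ g₂ ⊗≫ h₁ ◁ σ ⊗≫ v.hom ▷ r₃)) ≫ v.inv ▷ r₃ := by
      simp [bicategoricalComp, rightAdjointSquare.vcomp]
    _ = _ := by
      rw [H]
      simp [bicategoricalComp]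

end Pasting

theorem leftMate_comp {g g' : a ⟶ c} {h h' : b ⟶ d}
    {l₁ : a ⟶ b} {r₁ : b ⟶ a} {l₂ : c ⟶ d} {r₂ : d ⟶ c} (adj₁ : l₁ ⊣ r₁) (adj₂ : l₂ ⊣ r₂)
    (u : g ⟶ g') (σ : r₁ ≫ g' ⟶ h' ≫ r₂) (v : h' ⟶ h) :
    (mateEquiv adj₁ adj₂).symm (r₁ ◁ u ≫ σ ≫ v ▷ r₂) =
      u ▷ l₂ ≫ (mateEquiv adj₁ adj₂).symm σ ≫ l₁ ◁ v := by
  simp only [mateEquiv_symm_apply']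
  calc
    _ = 𝟙 _ ⊗≫ (adj₁.unit ▷ g ≫ (l₁ ≫ r₁) ◁ u) ▷ l₂ ⊗≫ l₁ ◁ σ ▷ l₂ ⊗≫
        l₁ ◁ (v ▷ (r₂ ≫ l₂) ≫ h ◁ adj₂.counit) ⊗≫ 𝟙 _ := by bicategory
    _ = _ := by
      rw [← whisker_exchange, ← whisker_exchange]
      bicategory

theorem leftMate_unit {l : b ⟶ c} {r : c ⟶ b} (adj : l ⊣ r) {t : b ⟶ d} {t' : c ⟶ d}
    (ν : r ≫ t ⟶ t') (x : d ⟶ b) :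
    (mateEquiv adj adj).symm (𝟙 (r ≫ t ≫ x) ⊗≫ ν ▷ x ⊗≫ (t' ≫ x) ◁ adj.unit ⊗≫
      𝟙 ((t' ≫ x ≫ l) ≫ r)) =
      (α_ _ _ _).hom ≫ adj.homEquiv₁.symm ν ▷ (x ≫ l) ≫ (α_ _ _ _).hom := by
  rw [mateEquiv_symm_apply', Adjunction.homEquiv₁_symm_apply]
  calc
    _ = 𝟙 _ ⊗≫ adj.unit ▷ t ▷ x ▷ l ⊗≫ l ◁ ν ▷ x ▷ l ⊗≫
        (l ≫ t' ≫ x) ◁ leftZigzag adj.unit adj.counit ⊗≫ 𝟙 _ := by bicategory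
    _ = _ := by
      rw [adj.left_triangle]
      bicategory

theorem isIso_leftMate_unitors {l : b ⟶ c} {r : c ⟶ b} (adj : l ⊣ r) :
    IsIso ((mateEquiv adj adj).symm ((ρ_ r).hom ≫ (λ_ r).inv)) := by
  rw [← mateEquiv_leftUnitor_hom_rightUnitor_inv, Equiv.symm_apply_apply]
  infer_instance

end Mates

/-! ### The Beck–Chevalley condition -/

namespace RightBeckChevalley

variable {𝒞 : Type*} [Bicategory 𝒞] {a b c d : 𝒞} {g : a ⟶ b} {f : a ⟶ c} {h : b ⟶ d}
  {i : c ⟶ d} {β : g ≫ h ⟶ f ≫ i}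

theorem of_isIso_leftMate {lg : b ⟶ a} {li : d ⟶ c} (adjg : lg ⊣ g) (adji : li ⊣ i)
    (hβ : IsIso ((mateEquiv adjg adji).symm β)) : RightBeckChevalley β := by
  intro fR hR adjf adjh
  rw [← (mateEquiv adjg adji).apply_symm_apply β, Bicategory.iterated_mateEquiv_conjugateEquiv]
  infer_instance

theorem of_isIso_mateEquiv {fR : c ⟶ a} {hR : d ⟶ b} (adjf : f ⊣ fR) (adjh : h ⊣ hR)
    (hβ : IsIso (mateEquiv adjf adjh β)) : RightBeckChevalley β := by
  intro fR' hR' adjf' adjh'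
  have change_hR := mateEquiv_conjugateEquiv_vcomp adjf adjh adjh' β (𝟙 _)
  have change_fR := conjugateEquiv_mateEquiv_vcomp adjf' adjf adjh' (𝟙 _) β
  simp only [leftAdjointSquareConjugate.vcomp, rightAdjointSquareConjugate.vcomp,
    leftAdjointConjugateSquare.vcomp, rightAdjointConjugateSquare.vcomp, whiskerLeft_id,
    id_whiskerRight, Category.id_comp, Category.comp_id] at change_hR change_fR
  rw [change_fR, change_hR]
  infer_instance

theorem isIso_mateEquiv_hcomp {e z : 𝒞} {j : e ⟶ z} {fR : c ⟶ a} {hR : d ⟶ b}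
    {f' : c ⟶ e} {fR' : e ⟶ c} {h' : d ⟶ z} {hR' : z ⟶ d}
    (adjf : f ⊣ fR) (adjh : h ⊣ hR) (adjf' : f' ⊣ fR') (adjh' : h' ⊣ hR')
    {γ : i ≫ h' ⟶ f' ≫ j} (hβ : RightBeckChevalley β) (hγ : RightBeckChevalley γ) :
    IsIso (mateEquiv (adjf.comp adjf') (adjh.comp adjh') (leftAdjointSquare.hcomp β γ)) := by
  have := hβ _ _ adjf adjh
  have := hγ _ _ adjf' adjh'
  rw [Bicategory.mateEquiv_hcomp, rightAdjointSquare.hcomp]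
  infer_instance

end RightBeckChevalley

/-! ### Semisimple linear categories -/

section SimpleBasis

/-- A system of simple objects `e a` with `Hom (e a, e b) = 0` for `a ≠ b` and one-dimensional
`End (e a)`, of which all objects are finite direct sums (up to retracts). -/
structure SimpleBasis (k : Type*) [Field k] (𝒯 : Type*) [Category 𝒯] [Preadditive 𝒯] [Linear k 𝒯]
    (N : Type) where
  e : N → 𝒯
  hom_eq_zero : ∀ {a b : N} (f : e a ⟶ e b), a ≠ b → f = 0
  exists_eq_smul_id : ∀ {a : N} (f : e a ⟶ e a), ∃ c : k, f = c • 𝟙 (e a)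
  exists_decomposition : ∀ X : 𝒯, ∃ (T : Type) (_ : Fintype T) (i : T → N)
    (p : ∀ t, X ⟶ e (i t)) (q : ∀ t, e (i t) ⟶ X), ∑ t, p t ≫ q t = 𝟙 X

theorem finite_sigma_fin {N : Type*} {d : N → ℕ} (hd : {a | d a ≠ 0}.Finite) :
    Finite (Σ a, Fin (d a)) := by
  have := hd.to_subtype
  refine .of_injective (β := Σ a : {a | d a ≠ 0}, Fin (d a))
    (fun t => ⟨⟨t.1, t.2.pos.ne'⟩, t.2⟩) ?_
  rintro ⟨a, s⟩ ⟨a', s'⟩ h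
  cases h
  rfl

namespace SimpleBasis

variable {k : Type*} [Field k] {𝒯 : Type*} [Category 𝒯] [Preadditive 𝒯] [Linear k 𝒯] {N : Type}
  (S : SimpleBasis k 𝒯 N)

theorem finite_hom_simple (a b : N) : Module.Finite k (S.e a ⟶ S.e b) := by
  obtain rfl | hab := eq_or_ne a b
  · refine .of_surjective (LinearMap.toSpanSingleton k _ (𝟙 (S.e a))) fun f => ?_
    obtain ⟨c, rfl⟩ := S.exists_eq_smul_id f
    exact ⟨c, rfl⟩
  · have : Subsingleton (S.e a ⟶ S.e b) := subsingleton_of_forall_eq 0 (S.hom_eq_zero · hab)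
    infer_instance

include S in
theorem finite_hom (X Y : 𝒯) : Module.Finite k (X ⟶ Y) := by
  obtain ⟨T, _, i, p, q, hX⟩ := S.exists_decomposition X
  obtain ⟨T', _, i', p', q', hY⟩ := S.exists_decomposition Y
  have := fun a b => S.finite_hom_simple a b
  let entries : (X ⟶ Y) →ₗ[k] ∀ (t : T) (t' : T'), S.e (i t) ⟶ S.e (i' t') :=
    LinearMap.pi fun t => LinearMap.pi fun t' =>
      Linear.rightComp k _ (p' t') ∘ₗ Linear.leftComp k _ (q t)
  refine .of_injective entries fun f g hfg => ?_
  have expand (f : X ⟶ Y) : f = ∑ t, ∑ t', p t ≫ entries f t t' ≫ q' t' := by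
    calc f = (∑ t, p t ≫ q t) ≫ f ≫ ∑ t', p' t' ≫ q' t' := by
          rw [hX, hY, Category.id_comp, Category.comp_id]
      _ = _ := by
          simp only [entries, Preadditive.sum_comp, Preadditive.comp_sum, Category.assoc,
            LinearMap.pi_apply, LinearMap.comp_apply, Linear.rightComp_apply,
            Linear.leftComp_apply]
          exact Finset.sum_comm
  rw [expand f, expand g, hfg]

variable {𝒟 : Type*} [Category 𝒟] [Preadditive 𝒟] (U : 𝒯 ⥤ 𝒟) [U.Additive]

theorem bijective_map_comp {Z : 𝒯} {Y : 𝒟} (ev : U.obj Z ⟶ Y)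
    (h : ∀ a, Function.Bijective fun f : S.e a ⟶ Z => U.map f ≫ ev) (X : 𝒯) :
    Function.Bijective fun f : X ⟶ Z => U.map f ≫ ev := by
  obtain ⟨T, _, i, p, q, hX⟩ := S.exists_decomposition X
  constructor
  · intro f g hfg
    have key (t) : q t ≫ f = q t ≫ g := (h (i t)).1 <| by
      simpa only [U.map_comp, Category.assoc] using congrArg (U.map (q t) ≫ ·) hfg
    rw [← Category.id_comp f, ← Category.id_comp g, ← hX]
    simp only [Preadditive.sum_comp, Category.assoc, key]
  · intro g
    choose l hl using fun t => (h (i t)).2 (U.map (q t) ≫ g)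
    refine ⟨∑ t, p t ≫ l t, ?_⟩
    simp only at hl
    simp only [U.map_sum, Preadditive.sum_comp, U.map_comp, Category.assoc, hl]
    simp only [← Category.assoc, ← U.map_comp]
    rw [← Preadditive.sum_comp, ← U.map_sum, hX, U.map_id, Category.id_comp]

open Limits

section Multiplicity

variable [HasFiniteBiproducts 𝒯] (d : N → ℕ) [Fintype (Σ a, Fin (d a))]

/-- The direct sum of simple objects with multiplicities `d`. -/
noncomputable def directSum : 𝒯 := ⨁ fun t : Σ a, Fin (d a) => S.e t.1

/-- The inclusion of the `s`-th copy of `e a`. -/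
noncomputable def ι {a : N} (s : Fin (d a)) : S.e a ⟶ S.directSum d :=
  biproduct.ι (fun t : Σ a, Fin (d a) => S.e t.1) ⟨a, s⟩

/-- The projection to the `s`-th copy of `e a`. -/
noncomputable def π {a : N} (s : Fin (d a)) : S.directSum d ⟶ S.e a :=
  biproduct.π (fun t : Σ a, Fin (d a) => S.e t.1) ⟨a, s⟩

theorem sum_π_ι : ∑ t : Σ a, Fin (d a), S.π d t.2 ≫ S.ι d t.2 = 𝟙 (S.directSum d) :=
  biproduct.total

theorem ι_π_self {a : N} (s : Fin (d a)) : S.ι d s ≫ S.π d s = 𝟙 (S.e a) :=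
  biproduct.ι_π_self _ _

theorem ι_π_ne {s t : Σ a, Fin (d a)} (h : s ≠ t) : S.ι d s.2 ≫ S.π d t.2 = 0 :=
  biproduct.ι_π_ne _ h

theorem map_ι_comp_sum {Y : 𝒟} (g : ∀ a, Fin (d a) → (U.obj (S.e a) ⟶ Y)) {a : N}
    (s : Fin (d a)) :
    U.map (S.ι d s) ≫ ∑ t : Σ a, Fin (d a), U.map (S.π d t.2) ≫ g t.1 t.2 = g a s := by
  classical
  rw [Preadditive.comp_sum, Finset.sum_eq_single (⟨a, s⟩ : Σ a, Fin (d a))]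
  · rw [← Category.assoc, ← U.map_comp, S.ι_π_self, U.map_id, Category.id_comp]
  · intro t _ ht
    rw [← Category.assoc, ← U.map_comp, S.ι_π_ne d ht.symm, U.map_zero, zero_comp]
  · simp

theorem surjective_sum_smul_ι (a : N) :
    Function.Surjective fun c : Fin (d a) → k => ∑ s, c s • S.ι d s := by
  intro h
  choose c hc using fun s : Fin (d a) => S.exists_eq_smul_id (h ≫ S.π d s)
  refine ⟨c, ?_⟩
  calc ∑ s, c s • S.ι d s = ∑ t : Σ a, Fin (d a), (h ≫ S.π d t.2) ≫ S.ι d t.2 :=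
        Fintype.sum_of_injective (Sigma.mk a) sigma_mk_injective (fun s => c s • S.ι d s)
          (fun t : Σ a, Fin (d a) => (h ≫ S.π d t.2) ≫ S.ι d t.2)
          (fun t ht => by
            rw [S.hom_eq_zero (h ≫ S.π d t.2) fun e => ht ⟨e ▸ t.2, by cases e; rfl⟩, zero_comp])
          (fun s => by rw [hc, Linear.smul_comp, Category.id_comp])
    _ = h := by
        simp only [Category.assoc]
        rw [← Preadditive.comp_sum, S.sum_π_ι, Category.comp_id]

end Multiplicity

variable [Linear k 𝒟] [U.Linear k]

theorem exists_bijective_map_comp [HasFiniteBiproducts 𝒯] {Y : 𝒟}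
    [∀ a, Module.Finite k (U.obj (S.e a) ⟶ Y)] (hY : {a | ∃ f : U.obj (S.e a) ⟶ Y, f ≠ 0}.Finite) :
    ∃ (Z : 𝒯) (ev : U.obj Z ⟶ Y), ∀ a, Function.Bijective fun f : S.e a ⟶ Z => U.map f ≫ ev := by
  let d (a : N) : ℕ := Module.finrank k (U.obj (S.e a) ⟶ Y)
  let b (a : N) : Module.Basis (Fin (d a)) k (U.obj (S.e a) ⟶ Y) := Module.finBasis k _
  have : Finite (Σ a, Fin (d a)) := finite_sigma_fin <| hY.subset fun a ha =>
    have := Module.nontrivial_of_finrank_pos (Nat.pos_of_ne_zero ha)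
    exists_ne 0
  let _ := Fintype.ofFinite (Σ a, Fin (d a))
  let ev : U.obj (S.directSum d) ⟶ Y := ∑ t : Σ a, Fin (d a), U.map (S.π d t.2) ≫ b t.1 t.2
  have ι_ev {a : N} (s : Fin (d a)) : U.map (S.ι d s) ≫ ev = b a s :=
    S.map_ι_comp_sum U d (fun a => b a) s
  refine ⟨_, ev, fun a => ?_⟩
  have comp_eq : (fun f => U.map f ≫ ev) ∘ (fun c : Fin (d a) → k => ∑ s, c s • S.ι d s) =
      (b a).equivFun.symm := by
    funext c
    simp only [Function.comp_apply, U.map_sum, Preadditive.sum_comp, U.map_smul, Linear.smul_comp,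
      ι_ev, Module.Basis.equivFun_symm_apply]
  have bijective_comp := (b a).equivFun.symm.bijective
  rw [← comp_eq] at bijective_comp
  exact ⟨bijective_comp.1.of_comp_right (S.surjective_sum_smul_ι d a), bijective_comp.2.of_comp⟩

theorem isLeftAdjoint [HasFiniteBiproducts 𝒯] [∀ a Y, Module.Finite k (U.obj (S.e a) ⟶ Y)]
    (hU : ∀ Y, {a | ∃ f : U.obj (S.e a) ⟶ Y, f ≠ 0}.Finite) : U.IsLeftAdjoint := by
  have (Y : 𝒟) : HasTerminal (CostructuredArrow U Y) := by
    obtain ⟨Z, ev, hev⟩ := S.exists_bijective_map_comp U (hU Y)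
    have bij := S.bijective_map_comp U ev hev
    have (W : CostructuredArrow U Y) : Nonempty (W ⟶ CostructuredArrow.mk ev) :=
      have ⟨l, hl⟩ := (bij W.left).2 W.hom
      ⟨CostructuredArrow.homMk l hl⟩
    have (W : CostructuredArrow U Y) : Subsingleton (W ⟶ CostructuredArrow.mk ev) :=
      ⟨fun f g => CostructuredArrow.hom_ext _ _ <|
        (bij W.left).1 ((CostructuredArrow.w f).trans (CostructuredArrow.w g).symm)⟩
    exact (IsTerminal.ofUniqueHom (fun W => Classical.arbitrary (W ⟶ CostructuredArrow.mk ev))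
      fun _ _ => Subsingleton.elim _ _).hasTerminal
  exact isLeftAdjoint_of_costructuredArrowTerminals U

section Opposite

instance linearOpposite : Linear k 𝒯ᵒᵖ where
  homModule X Y := (opEquiv X Y).module k
  smul_comp X Y Z r f g :=
    congrArg Quiver.Hom.op (Linear.comp_smul Z.unop Y.unop X.unop g.unop r f.unop)
  comp_smul X Y Z f r g :=
    congrArg Quiver.Hom.op (Linear.smul_comp Z.unop Y.unop X.unop r g.unop f.unop)

instance : U.op.Linear k where
  map_smul f r := congrArg Quiver.Hom.op (U.map_smul r f.unop)

/-- The simple objects of the opposite category. -/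
def op : SimpleBasis k 𝒯ᵒᵖ N where
  e a := .op (S.e a)
  hom_eq_zero f h := Quiver.Hom.unop_inj (S.hom_eq_zero f.unop h.symm)
  exists_eq_smul_id f := (S.exists_eq_smul_id f.unop).imp fun _ hc => Quiver.Hom.unop_inj hc
  exists_decomposition X := by
    obtain ⟨T, _, i, p, q, h⟩ := S.exists_decomposition X.unop
    refine ⟨T, inferInstance, i, fun t => (q t).op, fun t => (p t).op, Quiver.Hom.unop_inj ?_⟩
    rw [unop_sum]
    exact h

theorem isRightAdjoint [HasFiniteBiproducts 𝒯]
    [∀ (Y : 𝒟) (a : N), Module.Finite k (Y ⟶ U.obj (S.e a))]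
    (hU : ∀ Y, {a | ∃ f : Y ⟶ U.obj (S.e a), f ≠ 0}.Finite) : U.IsRightAdjoint := by
  have : HasFiniteBiproducts 𝒯ᵒᵖ := .of_hasFiniteProducts
  have (a : N) (Y : 𝒟ᵒᵖ) : Module.Finite k (U.op.obj (S.op.e a) ⟶ Y) :=
    have : Module.Finite k (Y.unop ⟶ (U.op.obj (S.op.e a)).unop) :=
      inferInstanceAs (Module.Finite k (Y.unop ⟶ U.obj (S.e a)))
    .equiv ((opEquiv (U.op.obj (S.op.e a)) Y).linearEquiv k).symm
  have : U.op.IsLeftAdjoint := S.op.isLeftAdjoint U.op fun Y =>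
    (hU Y.unop).subset fun a ⟨f, hf⟩ => ⟨f.unop, fun h => hf (Quiver.Hom.unop_inj h)⟩
  exact ⟨_, ⟨(CategoryTheory.Adjunction.ofIsLeftAdjoint U.op).unop⟩⟩

end Opposite

end SimpleBasis
end SimpleBasis

section Coordinates

open Limits

/-- A presentation of a `k`-linear category as the category of finitely supported families, indexed
by `N`, of finite dimensional vector spaces; `coord a` is the `a`-th member of the family. -/
structure Coordinates (k : Type u) [Field k] (𝒯 : Type*) [Category 𝒯] [Preadditive 𝒯] [Linear k 𝒯]
    (N : Type) where
  coord : N → 𝒯 ⥤ FGModuleCat.{u} k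
  [additive : ∀ a, (coord a).Additive]
  [linear : ∀ a, (coord a).Linear k]
  bijective_map : ∀ X Y, Function.Bijective fun (f : X ⟶ Y) a => (coord a).map f
  finite_support : ∀ X, {a | ¬ IsZero ((coord a).obj X)}.Finite
  exists_iso : ∀ V : N → FGModuleCat.{u} k, {a | ¬ IsZero (V a)}.Finite →
    ∃ X, ∀ a, Nonempty ((coord a).obj X ≅ V a)

attribute [instance] Coordinates.additive Coordinates.linear

theorem isZero_of_subsingleton {k : Type u} [Field k] (V : FGModuleCat.{u} k) [Subsingleton V] :
    IsZero V :=
  (IsZero.iff_id_eq_zero V).2 <| by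
    ext x
    exact Subsingleton.elim (α := V) _ _

namespace Coordinates

variable {k : Type u} [Field k] {𝒯 : Type*} [Category 𝒯] [Preadditive 𝒯] [Linear k 𝒯] {N : Type}
  (M : Coordinates k 𝒯 N)

theorem hom_ext {X Y : 𝒯} {f g : X ⟶ Y} (h : ∀ a, (M.coord a).map f = (M.coord a).map g) : f = g :=
  (M.bijective_map X Y).1 (funext h)

theorem exists_map_eq {X Y : 𝒯} (f : ∀ a, (M.coord a).obj X ⟶ (M.coord a).obj Y) :
    ∃ g : X ⟶ Y, ∀ a, (M.coord a).map g = f a :=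
  ((M.bijective_map X Y).2 f).imp fun _ => congrFun

theorem isZero_of_coord {X : 𝒯} (h : ∀ a, IsZero ((M.coord a).obj X)) : IsZero X :=
  (IsZero.iff_id_eq_zero X).2 (M.hom_ext fun a => (h a).eq_of_src _ _)

include M in
theorem hasFiniteBiproducts : HasFiniteBiproducts 𝒯 := by
  have : HasFiniteBiproducts (FGModuleCat.{u} k) := Abelian.hasFiniteBiproducts
  refine ⟨fun n => ⟨fun X => ?_⟩⟩
  obtain ⟨Z, E⟩ := M.exists_iso (fun a => ⨁ fun t => (M.coord a).obj (X t)) <| by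
    refine (Set.finite_iUnion fun t => M.finite_support (X t)).subset fun a ha => ?_
    by_contra hX
    simp only [Set.mem_iUnion, Set.mem_ofPred_eq, not_exists, not_not] at hX
    exact ha ((IsZero.iff_id_eq_zero _).2 <|
      biproduct.hom_ext _ _ fun t => (hX t).eq_of_tgt _ _)
  let E a := (E a).some
  choose ι hι using fun t => M.exists_map_eq fun a =>
    biproduct.ι (fun t => (M.coord a).obj (X t)) t ≫ (E a).inv
  choose π hπ using fun t => M.exists_map_eq fun a =>
    (E a).hom ≫ biproduct.π (fun t => (M.coord a).obj (X t)) t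
  refine hasBiproduct_of_total (Bicone.mk Z π ι fun s t => M.hom_ext fun a => ?_)
    (M.hom_ext fun a => ?_)
  · rw [Functor.map_comp, hι, hπ, Category.assoc, Iso.inv_hom_id_assoc, biproduct.ι_π,
      apply_dite (M.coord a).map]
    simp only [eqToHom_map, Functor.map_zero]
  · simp only [Functor.map_sum, Functor.map_comp, hι, hπ, Category.assoc,
      CategoryTheory.Functor.map_id]
    rw [← Preadditive.comp_sum]
    simp only [← Category.assoc (biproduct.π _ _), ← Preadditive.sum_comp, biproduct.total,
      Category.id_comp, Iso.hom_inv_id]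

theorem exists_simple (a : N) : ∃ X, Nonempty ((M.coord a).obj X ≅ FGModuleCat.of k k) ∧
    ∀ b, b ≠ a → IsZero ((M.coord b).obj X) := by
  classical
  have hzero : IsZero (FGModuleCat.of k PUnit.{u + 1}) := isZero_of_subsingleton _
  obtain ⟨X, E⟩ := M.exists_iso (fun b => if b = a then .of k k else .of k PUnit) <|
    (Set.finite_singleton a).subset fun b hb => by
      by_contra hba
      exact hb (if_neg hba ▸ hzero)
  refine ⟨X, ?_, fun b hba => ?_⟩
  · simpa only [if_pos] using E a
  · exact hzero.of_iso ((E b).some ≪≫ eqToIso (if_neg hba))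

/-- The object whose `a`-th coordinate is the ground field, all others being zero. -/
noncomputable def simple (a : N) : 𝒯 := (M.exists_simple a).choose

/-- The nonzero coordinate of a simple object. -/
noncomputable def simpleIso (a : N) : (M.coord a).obj (M.simple a) ≅ FGModuleCat.of k k :=
  (M.exists_simple a).choose_spec.1.some

theorem isZero_coord_simple {a b : N} (h : b ≠ a) : IsZero ((M.coord b).obj (M.simple a)) :=
  (M.exists_simple a).choose_spec.2 b h

theorem exists_eq_smul_id_simple {a : N} (f : M.simple a ⟶ M.simple a) :
    ∃ c : k, f = c • 𝟙 (M.simple a) := by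
  have finrank_eq_one : Module.finrank k ((M.coord a).obj (M.simple a)) = 1 :=
    (FGModuleCat.isoToLinearEquiv (M.simpleIso a)).finrank_eq.trans (Module.finrank_self k)
  obtain ⟨c, hc, -⟩ := LinearMap.existsUnique_eq_smul_id_of_finrank_eq_one finrank_eq_one
    ((M.coord a).map f).hom.hom
  refine ⟨c, M.hom_ext fun b => ?_⟩
  obtain rfl | hba := eq_or_ne b a
  · rw [Functor.map_smul, CategoryTheory.Functor.map_id]
    exact FGModuleCat.hom_ext hc
  · exact (M.isZero_coord_simple hba).eq_of_src _ _

theorem exists_sum_eq_id (V : FGModuleCat.{u} k) :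
    ∃ (p : Fin (Module.finrank k V) → (V ⟶ .of k k)) (q : _ → (.of k k ⟶ V)),
      ∑ s, p s ≫ q s = 𝟙 V := by
  let b := Module.finBasis k V
  refine ⟨fun s => FGModuleCat.ofHom (b.coord s),
    fun s => FGModuleCat.ofHom (LinearMap.toSpanSingleton k V (b s)), ?_⟩
  apply (forget₂ (FGModuleCat.{u} k) (ModuleCat.{u} k)).map_injective
  ext x
  rw [Functor.map_sum, ModuleCat.hom_sum, LinearMap.sum_apply]
  exact b.sum_repr x

theorem exists_decomposition (X : 𝒯) : ∃ (T : Type) (_ : Fintype T) (i : T → N)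
    (p : ∀ t, X ⟶ M.simple (i t)) (q : ∀ t, M.simple (i t) ⟶ X), ∑ t, p t ≫ q t = 𝟙 X := by
  classical
  let r (a : N) : ℕ := Module.finrank k ((M.coord a).obj X)
  have : Finite (Σ a, Fin (r a)) := finite_sigma_fin <| (M.finite_support X).subset
    fun a ha hz => ha <| by
      have := FGModuleCat.isoToLinearEquiv (hz.iso (isZero_of_subsingleton (.of k PUnit)))
      exact this.finrank_eq.trans Module.finrank_zero_of_subsingleton
  let _ := Fintype.ofFinite (Σ a, Fin (r a))
  choose p q hpq using fun a => exists_sum_eq_id ((M.coord a).obj X)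
  choose p' hp' using fun t : Σ a, Fin (r a) => M.exists_map_eq (X := X) (Y := M.simple t.1)
    (Pi.single t.1 (p t.1 t.2 ≫ (M.simpleIso t.1).inv))
  choose q' hq' using fun t : Σ a, Fin (r a) => M.exists_map_eq (X := M.simple t.1) (Y := X)
    (Pi.single t.1 ((M.simpleIso t.1).hom ≫ q t.1 t.2))
  refine ⟨_, inferInstance, _, p', q', M.hom_ext fun b => ?_⟩
  calc (M.coord b).map (∑ t, p' t ≫ q' t)
      = ∑ t, (M.coord b).map (p' t) ≫ (M.coord b).map (q' t) := by
        simp only [Functor.map_sum, Functor.map_comp]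
    _ = ∑ s, p b s ≫ q b s := .symm <|
        Fintype.sum_of_injective (Sigma.mk b) sigma_mk_injective (fun s => p b s ≫ q b s)
          (fun t : Σ a, Fin (r a) => (M.coord b).map (p' t) ≫ (M.coord b).map (q' t))
          (fun t ht => by
            rw [hp', Pi.single_eq_of_ne (by rintro rfl; exact ht ⟨t.2, rfl⟩), zero_comp])
          (fun s => by
            rw [hp', hq', Pi.single_eq_same, Pi.single_eq_same, Category.assoc,
              Iso.inv_hom_id_assoc])
    _ = (M.coord b).map (𝟙 X) := by rw [hpq, CategoryTheory.Functor.map_id]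

/-- The simple objects of a category of families of vector spaces. -/
noncomputable def simpleBasis : SimpleBasis k 𝒯 N where
  e := M.simple
  hom_eq_zero {a b} f h := M.hom_ext fun c => by
    obtain rfl | hca := eq_or_ne c a
    · exact (M.isZero_coord_simple h).eq_of_tgt _ _
    · exact (M.isZero_coord_simple hca).eq_of_src _ _
  exists_eq_smul_id := M.exists_eq_smul_id_simple
  exists_decomposition := M.exists_decomposition

end Coordinates
end Coordinates

/-! ### Linear functors between graded 2-vector spaces -/

variable {k : Type u} [Field k]

theorem TwoVect.exists_coordinates (C : TwoVect.{u, v, w} k) :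
    ∃ r : ℕ, Nonempty (Coordinates k C.carrier (Fin r)) := by
  obtain ⟨r, E, hE⟩ := C.exists_equivalence
  have (i : Fin r) := (hE i).1
  have (i : Fin r) := (hE i).2
  refine ⟨r, ⟨{
    coord := fun i => E.functor ⋙ Pi.eval _ i
    bijective_map := fun X Y => E.fullyFaithfulFunctor.map_bijective X Y
    finite_support := fun X => Set.toFinite _
    exists_iso := fun V _ =>
      ⟨E.inverse.obj V, fun i => ⟨(Pi.eval _ i).mapIso (E.counitIso.app V)⟩⟩ }⟩⟩

namespace Tot

instance (C : TwoVectGr.{u, v, w} k) : Preadditive (Tot C) where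
  add_comp _ _ _ f g h := funext fun n => Preadditive.add_comp _ _ _ (f n) (g n) (h n)
  comp_add _ _ _ f g h := funext fun n => Preadditive.comp_add _ _ _ (f n) (g n) (h n)

instance (C : TwoVectGr.{u, v, w} k) : Linear k (Tot C) where
  smul_comp _ _ _ c f g := funext fun n => Linear.smul_comp _ _ _ c (f n) (g n)
  comp_smul _ _ _ f c g := funext fun n => Linear.comp_smul _ _ _ (f n) c (g n)

variable {C D : TwoVectGr.{u, v, w} k}

/-- The part in degree `n`. -/
def component (C : TwoVectGr.{u, v, w} k) (n : ℕ) : Tot C ⥤ (C n).carrier where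
  obj X := X.obj n
  map f := f n

instance (n : ℕ) : (component C n).Additive where

instance (n : ℕ) : (component C n).Linear k where

theorem mem_supp_of_ne_zero {X Y : Tot C} {f : X ⟶ Y} (hf : f ≠ 0) :
    ∃ n, n ∈ X.supp ∧ n ∈ Y.supp := by
  by_contra! h
  refine hf (funext fun n => ?_)
  by_cases hn : n ∈ X.supp
  · exact (not_not.1 (h n hn)).eq_of_tgt _ _
  · exact (not_not.1 hn).eq_of_src _ _

theorem finite_sigma_fst {N : ℕ → Type*} [∀ n, Finite (N n)] {s : Set ℕ} (hs : s.Finite) :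
    {a : Σ n, N n | a.1 ∈ s}.Finite :=
  hs.preimage' fun n _ => (Set.finite_range (Sigma.mk n)).subset <| by
    rintro ⟨_, i⟩ rfl
    exact ⟨i, rfl⟩

/-- Coordinates on a graded 2-vector space, assembled from coordinates in each degree. -/
noncomputable def coordinates {N : ℕ → Type} [∀ n, Finite (N n)]
    (M : ∀ n, Coordinates k (C n).carrier (N n)) : Coordinates k (Tot C) (Σ n, N n) where
  coord a := component C a.1 ⋙ (M a.1).coord a.2
  bijective_map X Y := by
    refine ⟨fun f g h => funext fun n => (M n).hom_ext fun i => congrFun h ⟨n, i⟩, fun f => ?_⟩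
    choose g hg using fun n => (M n).exists_map_eq (X := X.obj n) (Y := Y.obj n)
      fun i => f ⟨n, i⟩
    exact ⟨g, funext fun a => hg a.1 a.2⟩
  finite_support X := (finite_sigma_fst X.finite).subset fun a ha h =>
    ha (((M a.1).coord a.2).map_isZero h)
  exists_iso V hV := by
    choose X E using fun n => (M n).exists_iso (fun i => V ⟨n, i⟩) (Set.toFinite _)
    refine ⟨⟨X, (hV.image Sigma.fst).subset fun n hn => ?_⟩, fun a => E a.1 a.2⟩
    by_contra h
    refine hn ((M n).isZero_of_coord fun i => ?_)
    have hi : Limits.IsZero (V ⟨n, i⟩) := by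
      by_contra hi
      exact h ⟨⟨n, i⟩, hi, rfl⟩
    exact hi.of_iso (E n i).some

theorem exists_simpleBasis (C : TwoVectGr.{u, v, w} k) :
    ∃ (r : ℕ → ℕ) (S : SimpleBasis k (Tot C) (Σ n, Fin (r n))), ∀ a, (S.e a).supp ⊆ {a.1} := by
  choose r M using fun n => (C n).exists_coordinates
  let M n := (M n).some
  refine ⟨r, (coordinates M).simpleBasis, fun a n hn => ?_⟩
  by_contra h
  exact hn ((M n).isZero_of_coord fun i =>
    (coordinates M).isZero_coord_simple (b := ⟨n, i⟩) fun e => h (congrArg Sigma.fst e))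

instance (C : TwoVectGr.{u, v, w} k) : Limits.HasFiniteBiproducts (Tot C) := by
  choose r M using fun n => (C n).exists_coordinates
  exact (coordinates fun n => (M n).some).hasFiniteBiproducts

instance (X Y : Tot C) : Module.Finite k (X ⟶ Y) :=
  have ⟨_, S, _⟩ := exists_simpleBasis C
  S.finite_hom X Y

theorem exists_ne_zero {X : Tot C} {n : ℕ} (hn : n ∈ X.supp) :
    ∃ (Y : Tot C) (p : X ⟶ Y) (q : Y ⟶ X), Y.supp ⊆ {n} ∧ p ≠ 0 ∧ q ≠ 0 := by
  obtain ⟨r, S, hS⟩ := exists_simpleBasis C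
  obtain ⟨T, _, i, p, q, hX⟩ := S.exists_decomposition X
  obtain ⟨t, ht⟩ : ∃ t, (p t ≫ q t) n ≠ 0 := by
    by_contra! h
    have component_eq_zero : (component C n).map (∑ t, p t ≫ q t) = 0 :=
      ((component C n).map_sum _ _).trans (Finset.sum_eq_zero fun t _ => h t)
    rw [hX] at component_eq_zero
    exact hn ((Limits.IsZero.iff_id_eq_zero _).2 component_eq_zero)
  have hpq : p t ≫ q t ≠ 0 := fun h => ht (congrFun h n)
  have hin : (i t).1 = n := by
    by_contra hin
    have : n ∉ (S.e (i t)).supp := fun h => hin (hS _ h).symm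
    exact ht ((congrArg (p t n ≫ ·) ((not_not.1 this).eq_of_src (q t n) 0)).trans Limits.comp_zero)
  exact ⟨_, p t, q t, hin ▸ hS (i t), fun h => hpq (by rw [h, Limits.zero_comp]),
    fun h => hpq (by rw [h, Limits.comp_zero])⟩

/-- A functor in one variable has bounded degree when, for some bound `B`, every nonvanishing degree
of `G X` differs by at most `B` from a nonvanishing degree of `X`. -/
def IsBoundedFunctor (G : Tot C ⥤ Tot D) : Prop :=
  ∃ B : ℕ, ∀ X, ∀ m ∈ (G.obj X).supp, ∃ n ∈ X.supp, |(m : ℤ) - n| ≤ B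

theorem finite_abs_sub_le {s : Set ℕ} (hs : s.Finite) (B : ℕ) :
    {n : ℕ | ∃ m ∈ s, |(m : ℤ) - n| ≤ B}.Finite := by
  obtain ⟨b, hb⟩ := hs.bddAbove
  refine (Set.finite_Iic (b + B)).subset ?_
  rintro n ⟨m, hm, h⟩
  have := hb hm
  rw [abs_le] at h
  simp only [Set.mem_Iic]
  omega

section Adjoint

variable {G : Tot C ⥤ Tot D} [G.Additive]

theorem isLeftAdjoint_of_isBounded [G.Linear k] (hG : IsBoundedFunctor G) : G.IsLeftAdjoint := by
  obtain ⟨r, S, hS⟩ := exists_simpleBasis C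
  obtain ⟨B, hB⟩ := hG
  refine S.isLeftAdjoint G fun Y => (finite_sigma_fst (finite_abs_sub_le Y.finite B)).subset ?_
  rintro a ⟨f, hf⟩
  obtain ⟨m, hm, hmY⟩ := mem_supp_of_ne_zero hf
  obtain ⟨n, hn, hmn⟩ := hB _ m hm
  obtain rfl := hS a hn
  exact ⟨m, hmY, hmn⟩

theorem isRightAdjoint_of_isBounded [G.Linear k] (hG : IsBoundedFunctor G) : G.IsRightAdjoint := by
  obtain ⟨r, S, hS⟩ := exists_simpleBasis C
  obtain ⟨B, hB⟩ := hG
  refine S.isRightAdjoint G fun Y => (finite_sigma_fst (finite_abs_sub_le Y.finite B)).subset ?_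
  rintro a ⟨f, hf⟩
  obtain ⟨m, hmY, hm⟩ := mem_supp_of_ne_zero hf
  obtain ⟨n, hn, hmn⟩ := hB _ m hm
  obtain rfl := hS a hn
  exact ⟨m, hmY, hmn⟩

variable {R : Tot D ⥤ Tot C}

theorem isBounded_rightAdjoint (adj : CategoryTheory.Adjunction G R) (hG : IsBoundedFunctor G) :
    IsBoundedFunctor R := by
  obtain ⟨B, hB⟩ := hG
  refine ⟨B, fun Y m hm => ?_⟩
  obtain ⟨Z, _, q, hZ, -, hq⟩ := exists_ne_zero hm
  have := adj.right_adjoint_additive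
  have transpose_ne_zero : (adj.homEquiv Z Y).symm q ≠ 0 := fun h => hq <| by
    rw [Equiv.symm_apply_eq] at h
    rw [h, Adjunction.homEquiv_unit, R.map_zero, Limits.comp_zero]
  obtain ⟨n, hn, hnY⟩ := mem_supp_of_ne_zero transpose_ne_zero
  obtain ⟨m', hm', h⟩ := hB _ n hn
  obtain rfl := hZ hm'
  exact ⟨n, hnY, abs_sub_comm (n : ℤ) m' ▸ h⟩

theorem isBounded_leftAdjoint (adj : CategoryTheory.Adjunction R G) (hG : IsBoundedFunctor G) :
    IsBoundedFunctor R := by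
  obtain ⟨B, hB⟩ := hG
  refine ⟨B, fun Y m hm => ?_⟩
  obtain ⟨Z, p, _, hZ, hp, -⟩ := exists_ne_zero hm
  have := adj.left_adjoint_additive
  have transpose_ne_zero : adj.homEquiv Y Z p ≠ 0 := fun h => hp <| by
    rw [← Equiv.eq_symm_apply] at h
    rw [h, Adjunction.homEquiv_counit, R.map_zero, Limits.zero_comp]
  obtain ⟨n, hnY, hn⟩ := mem_supp_of_ne_zero transpose_ne_zero
  obtain ⟨m', hm', h⟩ := hB _ n hn
  obtain rfl := hZ hm'
  exact ⟨n, hnY, abs_sub_comm (n : ℤ) m' ▸ h⟩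

end Adjoint

end Tot

section AdjointLinear

variable {𝒯 𝒟 : Type*} [Category 𝒯] [Preadditive 𝒯] [Linear k 𝒯] [Category 𝒟] [Preadditive 𝒟]
  [Linear k 𝒟] {F : 𝒯 ⥤ 𝒟} {G : 𝒟 ⥤ 𝒯}

theorem linear_rightAdjoint (adj : CategoryTheory.Adjunction F G) [F.Additive] [F.Linear k] :
    G.Linear k where
  map_smul {X Y} f c := (adj.homEquiv _ _).symm.injective <| by
    simp only [Adjunction.homEquiv_counit, Functor.map_smul, Linear.smul_comp,
      Adjunction.counit_naturality, Linear.comp_smul]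

theorem linear_leftAdjoint (adj : CategoryTheory.Adjunction F G) [G.Additive] [G.Linear k] :
    F.Linear k where
  map_smul {X Y} f c := (adj.homEquiv _ _).injective <| by
    simp only [Adjunction.homEquiv_unit, Functor.map_smul, Linear.smul_comp,
      Adjunction.unit_naturality, Linear.comp_smul]

end AdjointLinear

section OneVariable

variable {ι : Type} {C : ι → TwoVectGr.{u, v, w} k} {D : TwoVectGr.{u, v, w} k}

/-- The product of categories indexed by a set with a single element `i₀`, as the target of its
only factor. Transport along `h i : i₀ = i` keeps the index set arbitrary, as it is a fibre of a
map in the applications. -/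
def fromPoint (C : ι → TwoVectGr.{u, v, w} k) (i₀ : ι) (h : ∀ i, i₀ = i) :
    Tot (C i₀) ⥤ ∀ i, Tot (C i) where
  obj x i := h i ▸ x
  map {x y} f i := Eq.rec (motive := fun i h => (h ▸ x : Tot (C i)) ⟶ (h ▸ y : Tot (C i))) f (h i)
  map_id x := by
    funext i
    obtain rfl := h i
    rfl
  map_comp f g := by
    funext i
    obtain rfl := h i
    rfl

/-- The natural isomorphism exhibiting `fromPoint` as inverse to evaluation at the only index. -/
def evalFromPoint (C : ι → TwoVectGr.{u, v, w} k) (i₀ : ι) (h : ∀ i, i₀ = i) :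
    Pi.eval (fun i => Tot (C i)) i₀ ⋙ fromPoint C i₀ h ≅ 𝟭 _ :=
  NatIso.ofComponents (fun X =>
    { hom := fun i =>
        Eq.rec (motive := fun i h => (h ▸ X i₀ : Tot (C i)) ⟶ X i) (𝟙 (X i₀)) (h i)
      inv := fun i =>
        Eq.rec (motive := fun i h => X i ⟶ (h ▸ X i₀ : Tot (C i))) (𝟙 (X i₀)) (h i)
      hom_inv_id := by
        funext i
        obtain rfl := h i
        exact Category.id_comp (𝟙 (X i₀))
      inv_hom_id := by
        funext i
        obtain rfl := h i
        exact Category.id_comp (𝟙 (X i₀)) }) <| by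
    intro X Y f
    funext i
    obtain rfl := h i
    exact (Category.comp_id (f i₀)).trans (Category.id_comp (f i₀)).symm

theorem fromPoint_map_eq_update [DecidableEq ι] (i₀ : ι) (h : ∀ i, i₀ = i) {x y : Tot (C i₀)}
    (m : ∀ i, (fromPoint C i₀ h).obj x i ⟶ (fromPoint C i₀ h).obj y i) (a : x ⟶ y) :
    (fromPoint C i₀ h).map a = Function.update m i₀ a := by
  funext i
  obtain rfl := h i
  exact (Function.update_self (f := m) i₀ a).symm

namespace MultiFun

/-- A multilinear functor whose set of variables has a single element, as a functor of one
variable. -/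
def unary (M : MultiFun C D) (i₀ : ι) (h : ∀ i, i₀ = i) : Tot (C i₀) ⥤ Tot D :=
  fromPoint C i₀ h ⋙ M.functor

/-- A multilinear functor whose set of variables has a single element is `MultiFun.unary` after
evaluation at this variable. -/
def isoUnary (M : MultiFun C D) (i₀ : ι) (h : ∀ i, i₀ = i) :
    M.functor ≅ Pi.eval _ i₀ ⋙ M.unary i₀ h :=
  (Functor.isoWhiskerRight (evalFromPoint C i₀ h) M.functor).symm

theorem map_eq_unary_map (M : MultiFun C D) (i₀ : ι) (h : ∀ i, i₀ = i) {X Y : ∀ i, Tot (C i)}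
    (a : X ⟶ Y) :
    M.functor.map a = (M.isoUnary i₀ h).hom.app X ≫ (M.unary i₀ h).map (a i₀) ≫
      (M.isoUnary i₀ h).inv.app Y :=
  (NatIso.naturality_2 (M.isoUnary i₀ h) a).symm

instance (M : MultiFun C D) (i₀ : ι) (h : ∀ i, i₀ = i) : (M.unary i₀ h).Additive where
  map_add {X Y f g} := by
    classical
    obtain ⟨N, hN⟩ := M.multilinear ((fromPoint C i₀ h).obj X) ((fromPoint C i₀ h).obj Y)
    have map_eq : ∀ a : X ⟶ Y, (M.unary i₀ h).map a = N (Function.update 0 i₀ a) := fun a =>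
      (congrArg M.functor.map (fromPoint_map_eq_update i₀ h 0 a)).trans (hN _).symm
    exact (map_eq _).trans
      ((N.map_update_add 0 i₀ f g).trans (congrArg₂ (· + ·) (map_eq f) (map_eq g)).symm)

instance (M : MultiFun C D) (i₀ : ι) (h : ∀ i, i₀ = i) : (M.unary i₀ h).Linear k where
  map_smul {X Y} f c := by
    classical
    obtain ⟨N, hN⟩ := M.multilinear ((fromPoint C i₀ h).obj X) ((fromPoint C i₀ h).obj Y)
    have map_eq : ∀ a : X ⟶ Y, (M.unary i₀ h).map a = N (Function.update 0 i₀ a) := fun a =>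
      (congrArg M.functor.map (fromPoint_map_eq_update i₀ h 0 a)).trans (hN _).symm
    exact (map_eq _).trans
      ((N.map_update_smul 0 i₀ c f).trans (congrArg (c • ·) (map_eq f)).symm)

theorem isBounded_unary (M : MultiFun C D) (i₀ : ι) (h : ∀ i, i₀ = i) :
    Tot.IsBoundedFunctor (M.unary i₀ h) := by
  obtain ⟨B, hB⟩ := M.bounded
  let _ : Unique ι := ⟨⟨i₀⟩, fun i => (h i).symm⟩
  refine ⟨B, fun X m hm => ?_⟩
  obtain ⟨n, hn, hnm⟩ := hB _ m hm
  exact ⟨n i₀, hn i₀, by rwa [finsum_unique] at hnm⟩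

/-- A linear functor of bounded degree, as a multilinear functor whose set of variables has a
single element. -/
def ofUnary (C : ι → TwoVectGr.{u, v, w} k) (i₀ : ι) (h : ∀ i, i₀ = i) (G : Tot (C i₀) ⥤ Tot D)
    [G.Additive] [G.Linear k] (hG : Tot.IsBoundedFunctor G) : MultiFun C D where
  functor := Pi.eval _ i₀ ⋙ G
  multilinear X Y := by
    refine ⟨⟨fun f => G.map (f i₀), ?_, ?_⟩, fun f => rfl⟩
    · intro _ f i a b
      obtain rfl := h i
      simp only [Function.update_self]
      exact G.map_add
    · intro _ f i c a
      obtain rfl := h i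
      simp only [Function.update_self]
      exact Functor.Linear.map_smul a c
  bounded := by
    obtain ⟨B, hB⟩ := hG
    let _ : Unique ι := ⟨⟨i₀⟩, fun i => (h i).symm⟩
    refine ⟨B, fun X m hm => ?_⟩
    obtain ⟨n, hn, hnm⟩ := hB _ m hm
    refine ⟨fun _ => n, fun i => ?_, by rwa [finsum_unique]⟩
    obtain rfl := h i
    exact hn

end MultiFun

end OneVariable

/-! ### Adjoints of 1-morphisms over bijections -/

section Zigzag

theorem leftZigzag_eq {𝒞 : Type*} [Bicategory 𝒞] {a b : 𝒞} {f : a ⟶ b} {g : b ⟶ a}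
    (η : 𝟙 a ⟶ f ≫ g) (κ : g ≫ f ⟶ 𝟙 b) :
    leftZigzag η κ = η ▷ f ≫ (α_ _ _ _).hom ≫ f ◁ κ := by
  simp [leftZigzag, bicategoricalComp]

theorem rightZigzag_eq {𝒞 : Type*} [Bicategory 𝒞] {a b : 𝒞} {f : a ⟶ b} {g : b ⟶ a}
    (η : 𝟙 a ⟶ f ≫ g) (κ : g ≫ f ⟶ 𝟙 b) :
    rightZigzag η κ = g ◁ η ≫ (α_ _ _ _).inv ≫ κ ▷ g := by
  simp [rightZigzag, bicategoricalComp]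

variable {𝒳 𝒴 : Type*} [Category* 𝒳] [Category* 𝒴] {L : 𝒳 ⥤ 𝒴} {R : 𝒴 ⥤ 𝒳}

theorem left_triangle_conj (adj : CategoryTheory.Adjunction L R) {x z : 𝒳} {y w : 𝒴}
    (n : y ≅ L.obj x) (m : z ≅ R.obj y) (p : w ≅ L.obj z) :
    (n.hom ≫ L.map (adj.unit.app x ≫ R.map n.inv ≫ m.inv) ≫ p.inv) ≫
      (p.hom ≫ L.map m.hom) ≫ adj.counit.app y = 𝟙 y := by
  simp

theorem right_triangle_conj (adj : CategoryTheory.Adjunction L R) {x z : 𝒳} {y y' : 𝒴}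
    (n : y' ≅ L.obj x) (m : z ≅ R.obj y') (p : x ≅ R.obj y) :
    (adj.unit.app x ≫ R.map n.inv ≫ m.inv) ≫
      m.hom ≫ R.map ((n.hom ≫ L.map p.hom) ≫ adj.counit.app y) ≫ p.inv = 𝟙 x := by
  simp

end Zigzag

namespace TwoVectTensor

theorem whiskerLeft_app {A B C : TwoVectTensor.{u, v, w} k} (F : A ⟶ B) {G G' : B ⟶ C} (η : G ⟶ G')
    (l : C.base.Nonbase) (X : ∀ i : FinPt.Fiber (F ≫ G).base l, Tot (A.fam i.1)) :
    ((F ◁ η).app l).app X = (η.app l).app fun j => (F.comp j.1).functor.obj fun i =>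
      X ⟨i.1, (congrArg G.base.toFun i.2).trans j.2⟩ :=
  rfl

section Comp

variable {A B C : TwoVectTensor.{u, v, w} k}

/-- The restriction of families indexed by the fibre of a composition to a fibre of the first
map. -/
def restrict (F : A ⟶ B) (G : B ⟶ C) (l : C.base.Nonbase) (j : FinPt.Fiber G.base l) :
    (∀ i : FinPt.Fiber (F ≫ G).base l, Tot (A.fam i.1)) ⥤
      ∀ i : FinPt.Fiber F.base j.1, Tot (A.fam i.1) where
  obj X i := X ⟨i.1, (congrArg G.base.toFun i.2).trans j.2⟩
  map f i := f ⟨i.1, (congrArg G.base.toFun i.2).trans j.2⟩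

/-- The product of the components of `F` which is substituted into a component of `G`. -/
def compInner (F : A ⟶ B) (G : B ⟶ C) (l : C.base.Nonbase) :
    (∀ i : FinPt.Fiber (F ≫ G).base l, Tot (A.fam i.1)) ⥤
      ∀ j : FinPt.Fiber G.base l, Tot (B.fam j.1) :=
  Functor.pi' fun j => restrict F G l j ⋙ (F.comp j.1).functor

/-- The component of `F ≫ G` at `l`, if the component of `G` at `l` has a single variable. -/
def compIso (F : A ⟶ B) (G : B ⟶ C) {l : C.base.Nonbase} (j : FinPt.Fiber G.base l)
    (hj : ∀ x, j = x) :
    ((F ≫ G).comp l).functor ≅ restrict F G l j ⋙ (F.comp j.1).functor ⋙ (G.comp l).unary j hj :=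
  Functor.isoWhiskerLeft (compInner F G l) ((G.comp l).isoUnary j hj)

/-- The component of `F ≫ G` at `l`, if it is a composition of two functors of one variable. -/
def compIsoUnary (F : A ⟶ B) (G : B ⟶ C) {l : C.base.Nonbase} (j : FinPt.Fiber G.base l)
    (hj : ∀ x, j = x) (i : FinPt.Fiber F.base j.1) (hi : ∀ x, i = x) :
    ((F ≫ G).comp l).functor ≅
      Pi.eval _ (⟨i.1, (congrArg G.base.toFun i.2).trans j.2⟩ : FinPt.Fiber (F ≫ G).base l) ⋙
        (F.comp j.1).unary i hi ⋙ (G.comp l).unary j hj :=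
  compIso F G j hj ≪≫ Functor.isoWhiskerLeft (restrict F G l j)
    (Functor.isoWhiskerRight ((F.comp j.1).isoUnary i hi) ((G.comp l).unary j hj))

end Comp

section AdjunctionOfUnary

theorem fiber_unique {I J : FinPt} {φ : I ⟶ J} (hφ : Function.Injective φ.toFun) {i : I.Nonbase}
    {j : J.Nonbase} (h : φ.toFun i.1 = j.1) (x : FinPt.Fiber φ j) : ⟨i, h⟩ = x :=
  Subtype.ext (Subtype.ext (hφ (h.trans x.2.symm)))

theorem toFun_toFun {I J : FinPt} {φ : I ⟶ J} {ψ : J ⟶ I} (h : φ ≫ ψ = 𝟙 I) (i : I.carrier) :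
    ψ.toFun (φ.toFun i) = i :=
  congrArg (fun χ : I ⟶ I => χ.toFun i) h

theorem injective_toFun {I J : FinPt} {φ : I ⟶ J} {ψ : J ⟶ I} (h : φ ≫ ψ = 𝟙 I) :
    Function.Injective φ.toFun :=
  Function.LeftInverse.injective (toFun_toFun h)

/-- An injection of pointed sets, on elements other than the base point. -/
abbrev nonbaseMap {I J : FinPt} {φ : I ⟶ J} (hφ : Function.Injective φ.toFun) (i : I.Nonbase) :
    J.Nonbase :=
  ⟨φ.toFun i.1, fun h => i.2 (hφ (h.trans φ.map_pt.symm))⟩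

variable {A B : TwoVectTensor.{u, v, w} k}

/-- The component of a 1-morphism over an injection at an image point, as a functor of one
variable. -/
def unaryAt (f : A ⟶ B) (hf : Function.Injective f.base.toFun) {i : A.base.Nonbase}
    {j : B.base.Nonbase} (h : f.base.toFun i.1 = j.1) : Tot (A.fam i) ⥤ Tot (B.fam j) :=
  (f.comp j).unary ⟨i, h⟩ (fiber_unique hf h)

instance (f : A ⟶ B) (hf : Function.Injective f.base.toFun) {i : A.base.Nonbase}
    {j : B.base.Nonbase} (h : f.base.toFun i.1 = j.1) : (unaryAt f hf h).Additive :=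
  inferInstanceAs ((f.comp j).unary ⟨i, h⟩ _).Additive

instance (f : A ⟶ B) (hf : Function.Injective f.base.toFun) {i : A.base.Nonbase}
    {j : B.base.Nonbase} (h : f.base.toFun i.1 = j.1) : (unaryAt f hf h).Linear k :=
  inferInstanceAs (((f.comp j).unary ⟨i, h⟩ _).Linear k)

/-- The component of a composition of 1-morphisms over injections at an image point, as a
composition of functors of one variable. -/
def compIsoUnaryAt {C : TwoVectTensor.{u, v, w} k} (f : A ⟶ B) (g : B ⟶ C)
    (hf : Function.Injective f.base.toFun) (hg : Function.Injective g.base.toFun)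
    {i : A.base.Nonbase} {j : B.base.Nonbase} {l : C.base.Nonbase}
    (h : f.base.toFun i.1 = j.1) (h' : g.base.toFun j.1 = l.1) :
    ((f ≫ g).comp l).functor ≅
      Pi.eval _ (⟨i, (congrArg g.base.toFun h).trans h'⟩ : FinPt.Fiber (f ≫ g).base l) ⋙
        unaryAt f hf h ⋙ unaryAt g hg h' :=
  compIsoUnary f g ⟨j, h'⟩ (fiber_unique hg h') ⟨i, h⟩ (fiber_unique hf h)

variable {f : A ⟶ B} {r : B ⟶ A}
  (hfr : f.base ≫ r.base = 𝟙 A.base) (hrf : r.base ≫ f.base = 𝟙 B.base)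
  (adj : ∀ {i : A.base.Nonbase} {j : B.base.Nonbase} (h : f.base.toFun i.1 = j.1)
    (h' : r.base.toFun j.1 = i.1), CategoryTheory.Adjunction
      (unaryAt f (injective_toFun hfr) h) (unaryAt r (injective_toFun hrf) h'))

/-- The component at `i` of the unit of the adjunction between 1-morphisms over inverse bijections
given by adjunctions between their components. -/
def unitAt {i : A.base.Nonbase} {j : B.base.Nonbase} (h : f.base.toFun i.1 = j.1)
    (h' : r.base.toFun j.1 = i.1) :
    ((𝟙 A : A ⟶ A).comp i).functor ⟶ reindex A hfr.symm i ⋙ ((f ≫ r).comp i).functor :=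
  Functor.whiskerLeft (Pi.eval (fun i' : FinPt.Fiber (𝟙 A : A ⟶ A).base i => Tot (A.fam i'.1))
      ⟨i, rfl⟩) (adj h h').unit ≫
    Functor.whiskerLeft (reindex A hfr.symm i)
      (compIsoUnaryAt f r (injective_toFun hfr) (injective_toFun hrf) h h').inv

/-- The component at `j` of the counit of the adjunction between 1-morphisms over inverse bijections
given by adjunctions between their components. -/
def counitAt {i : A.base.Nonbase} {j : B.base.Nonbase} (h : f.base.toFun i.1 = j.1)
    (h' : r.base.toFun j.1 = i.1) :
    ((r ≫ f).comp j).functor ⟶ reindex B hrf j ⋙ ((𝟙 B : B ⟶ B).comp j).functor :=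
  (compIsoUnaryAt r f (injective_toFun hrf) (injective_toFun hfr) h' h).hom ≫
    Functor.whiskerLeft (Pi.eval (fun j' : FinPt.Fiber (r ≫ f).base j => Tot (B.fam j'.1))
      ⟨j, toFun_toFun hrf j.1⟩) (adj h h').counit

/-- The unit of the adjunction between 1-morphisms over inverse bijections given by adjunctions
between their components. -/
def unitOfUnary : 𝟙 A ⟶ f ≫ r :=
  Hom₂.mk (F := 𝟙 A) (G := f ≫ r) hfr.symm fun i =>
    unitAt hfr hrf adj (j := nonbaseMap (injective_toFun hfr) i) rfl (toFun_toFun hfr i.1)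

/-- The counit of the adjunction between 1-morphisms over inverse bijections given by adjunctions
between their components. -/
def counitOfUnary : r ≫ f ⟶ 𝟙 B :=
  Hom₂.mk (F := r ≫ f) (G := 𝟙 B) hrf fun j =>
    counitAt hfr hrf adj (i := nonbaseMap (injective_toFun hrf) j) (toFun_toFun hrf j.1) rfl

theorem unitOfUnary_app {i : A.base.Nonbase} {j : B.base.Nonbase} (h : f.base.toFun i.1 = j.1)
    (h' : r.base.toFun j.1 = i.1) :
    (unitOfUnary hfr hrf adj).app i = unitAt hfr hrf adj h h' := by
  obtain rfl : nonbaseMap (injective_toFun hfr) i = j := Subtype.ext h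
  rfl

theorem counitOfUnary_app {i : A.base.Nonbase} {j : B.base.Nonbase} (h : f.base.toFun i.1 = j.1)
    (h' : r.base.toFun j.1 = i.1) :
    (counitOfUnary hfr hrf adj).app j = counitAt hfr hrf adj h h' := by
  obtain rfl : nonbaseMap (injective_toFun hrf) j = i := Subtype.ext h'
  rfl

/-- The adjunction between 1-morphisms over inverse bijections given by adjunctions between their
components. -/
def adjunctionOfUnary : Bicategory.Adjunction f r where
  unit := unitOfUnary hfr hrf adj
  counit := counitOfUnary hfr hrf adj
  left_triangle := by
    rw [leftZigzag_eq]
    ext j X : 2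
    have h := toFun_toFun hrf j.1
    let i := nonbaseMap (injective_toFun hrf) j
    let ν := (f.comp j).isoUnary ⟨i, h⟩ (fiber_unique (injective_toFun hfr) h)
    refine (congrArg (_ ≫ ·) (Category.id_comp _)).trans (Eq.trans ?_ (Category.id_comp _).symm)
    refine (congrArg (· ≫ _) ((f.comp j).map_eq_unary_map ⟨i, h⟩
      (fiber_unique (injective_toFun hfr) h) _)).trans ?_
    rw [unitOfUnary_app hfr hrf adj h rfl, whiskerLeft_app,
      counitOfUnary_app hfr hrf adj (i := i) h rfl]
    exact left_triangle_conj (adj h rfl) (ν.app fun x => X ⟨x.1, x.2⟩)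
      (((r.comp i).isoUnary ⟨j, rfl⟩ (fiber_unique (injective_toFun hrf) rfl)).app
        fun y => (f.comp y.1).functor.obj fun x =>
          X ⟨x.1, x.2.trans (injective_toFun hrf y.2)⟩)
      (ν.app fun x => (r.comp x.1).functor.obj fun y => (f.comp y.1).functor.obj fun z =>
        X ⟨z.1, z.2.trans (injective_toFun hrf
          (y.2.trans (injective_toFun hfr (x.2.trans h.symm))))⟩)
  right_triangle := by
    rw [rightZigzag_eq]
    ext i Y : 2
    have h := toFun_toFun hfr i.1
    let j := nonbaseMap (injective_toFun hfr) i
    let ν := (r.comp i).isoUnary ⟨j, h⟩ (fiber_unique (injective_toFun hrf) h)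
    refine (congrArg (_ ≫ ·) (Category.id_comp _)).trans (Eq.trans ?_ (Category.id_comp _).symm)
    refine (congrArg (_ ≫ ·) ((r.comp i).map_eq_unary_map ⟨j, h⟩
      (fiber_unique (injective_toFun hrf) h) _)).trans ?_
    rw [counitOfUnary_app hfr hrf adj rfl h, whiskerLeft_app,
      unitOfUnary_app hfr hrf adj (j := j) rfl h]
    exact right_triangle_conj (adj rfl h)
      (((f.comp j).isoUnary ⟨i, rfl⟩ (fiber_unique (injective_toFun hfr) rfl)).app
        fun x => (r.comp x.1).functor.obj fun y =>
          Y ⟨y.1, y.2.trans (injective_toFun hfr x.2)⟩)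
      (ν.app fun y => (f.comp y.1).functor.obj fun x => (r.comp x.1).functor.obj fun z =>
        Y ⟨z.1, z.2.trans (injective_toFun hfr
          (x.2.trans (injective_toFun hrf (y.2.trans h.symm))))⟩)
      (ν.app fun y => Y ⟨y.1, y.2⟩)

end AdjunctionOfUnary

section ExistsAdjoint

variable {A B : TwoVectTensor.{u, v, w} k} (f : A ⟶ B) (hf : Function.Bijective f.base.toFun)

/-- The inverse of the map of pointed sets underlying a 1-morphism over a bijection. -/
noncomputable def baseInv : B.base ⟶ A.base :=
  ⟨(Equiv.ofBijective _ hf).symm, (Equiv.symm_apply_eq _).2 f.base.map_pt.symm⟩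

theorem base_comp_baseInv : f.base ≫ baseInv f hf = 𝟙 _ :=
  FinPt.hom_ext (Equiv.ofBijective _ hf).symm_apply_apply

theorem baseInv_comp_base : baseInv f hf ≫ f.base = 𝟙 _ :=
  FinPt.hom_ext (Equiv.ofBijective _ hf).apply_symm_apply

/-- The 1-morphism over the inverse of a bijection given by functors of one variable. -/
noncomputable def ofUnaryInv (G : ∀ i, Tot (B.fam (nonbaseMap hf.1 i)) ⥤ Tot (A.fam i))
    [∀ i, (G i).Additive] [∀ i, (G i).Linear k] (hG : ∀ i, Tot.IsBoundedFunctor (G i)) : B ⟶ A :=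
  Hom.mk (baseInv f hf) fun i =>
    MultiFun.ofUnary _ ⟨nonbaseMap hf.1 i, toFun_toFun (base_comp_baseInv f hf) i.1⟩
      (fiber_unique (injective_toFun (baseInv_comp_base f hf)) _) (G i) (hG i)

theorem exists_rightAdjoint (f : A ⟶ B) (hf : Function.Bijective f.base.toFun) :
    ∃ r : B ⟶ A, Nonempty (Bicategory.Adjunction f r) := by
  have isLeftAdjoint (i) : (unaryAt f hf.1 (i := i) (j := nonbaseMap hf.1 i) rfl).IsLeftAdjoint :=
    Tot.isLeftAdjoint_of_isBounded (MultiFun.isBounded_unary _ _ _)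
  choose R hR using fun i => (isLeftAdjoint i).exists_rightAdjoint
  let adj (i) := (hR i).some
  have : ∀ i, (R i).Additive := fun i => (adj i).right_adjoint_additive
  have : ∀ i, (R i).Linear k := fun i => linear_rightAdjoint (adj i)
  let r := ofUnaryInv f hf R fun i =>
    Tot.isBounded_rightAdjoint (adj i) (MultiFun.isBounded_unary _ _ _)
  refine ⟨r, ⟨adjunctionOfUnary (f := f) (r := r) (base_comp_baseInv f hf) (baseInv_comp_base f hf)
    fun {i j} h _ => ?_⟩⟩
  obtain rfl : nonbaseMap hf.1 i = j := Subtype.ext h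
  exact adj i

theorem exists_leftAdjoint (f : A ⟶ B) (hf : Function.Bijective f.base.toFun) :
    ∃ l : B ⟶ A, Nonempty (Bicategory.Adjunction l f) := by
  have isRightAdjoint (i) : (unaryAt f hf.1 (i := i) (j := nonbaseMap hf.1 i) rfl).IsRightAdjoint :=
    Tot.isRightAdjoint_of_isBounded (MultiFun.isBounded_unary _ _ _)
  choose L hL using fun i => (isRightAdjoint i).exists_leftAdjoint
  let adj (i) := (hL i).some
  have : ∀ i, (L i).Additive := fun i => (adj i).left_adjoint_additive
  have : ∀ i, (L i).Linear k := fun i => linear_leftAdjoint (adj i)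
  let l := ofUnaryInv f hf L fun i =>
    Tot.isBounded_leftAdjoint (adj i) (MultiFun.isBounded_unary _ _ _)
  refine ⟨l, ⟨adjunctionOfUnary (f := l) (r := f) (baseInv_comp_base f hf) (base_comp_baseInv f hf)
    fun {j i} _ h => ?_⟩⟩
  obtain rfl : nonbaseMap hf.1 i = j := Subtype.ext h
  exact adj i

end ExistsAdjoint

end TwoVectTensor

/-! ### Inert coCartesian 1-morphisms -/

namespace TwoVectTensor

section CoCartesian

variable {A B : TwoVectTensor.{u, v, w} k} {F : A ⟶ B}

namespace IsCoCartesian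

theorem faithful_precomp (hF : IsCoCartesian F) (Z : TwoVectTensor.{u, v, w} k) :
    (precomp Z F).Faithful where
  map_injective h := by
    have := hF Z
    exact (comparison F Z).map_injective
      (Limits.CategoricalPullback.hom_ext h (Subsingleton.elim _ _))

theorem full_precomp (hF : IsCoCartesian F) (hs : Function.Surjective F.base.toFun)
    (Z : TwoVectTensor.{u, v, w} k) : (precomp Z F).Full where
  map_surjective {G G'} θ := by
    have := hF Z
    have h : G.base = G'.base := FinPt.hom_ext <| hs.forall.2 fun i =>
      congrArg (fun φ => φ.toFun i) θ.base_eq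
    let θ' : (comparison F Z).obj G ⟶ (comparison F Z).obj G' :=
      ⟨θ, Discrete.eqToHom h, Subsingleton.elim _ _⟩
    obtain ⟨α, hα⟩ := (comparison F Z).map_surjective θ'
    exact ⟨α, congrArg Limits.CategoricalPullback.Hom.fst hα⟩

theorem mem_essImage_precomp (hF : IsCoCartesian F) {Z : TwoVectTensor.{u, v, w} k} (G : A ⟶ Z)
    (ψ : B.base ⟶ Z.base) (h : G.base = F.base ≫ ψ) : (precomp Z F).essImage G := by
  have := hF Z
  let Y : Limits.CategoricalPullback (projHom A Z) (precompBase F.base Z.base) :=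
    ⟨G, ⟨ψ⟩, Discrete.eqToIso h⟩
  exact ⟨_, ⟨(Limits.CategoricalPullback.π₁ _ _).mapIso ((comparison F Z).objObjPreimageIso Y)⟩⟩

end IsCoCartesian

theorem isIso_leftMate_of_isCoCartesian {A B C D : TwoVectTensor.{u, v, w} k} {L : A ⟶ B}
    {R : B ⟶ A} (adj : Bicategory.Adjunction L R) {L' : C ⟶ D} {R' : D ⟶ C}
    (adj' : Bicategory.Adjunction L' R') {q : A ⟶ C} {p : B ⟶ D} (σ : R ≫ q ⟶ p ≫ R') [IsIso σ]
    (hq : IsCoCartesian q) (hq' : Function.Surjective q.base.toFun)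
    (hp : IsCoCartesian p) (hp' : Function.Surjective p.base.toFun) :
    IsIso ((Bicategory.mateEquiv adj adj').symm σ) := by
  have := hq.faithful_precomp D
  have := hq.full_precomp hq' D
  have := hp.faithful_precomp D
  have := hp.full_precomp hp' D
  exact isIso_leftMate_of_fullyFaithful_precomp adj adj' σ <|
    hq.mem_essImage_precomp _ _ ((Bicategory.mateEquiv adj adj').symm σ).base_eq.symm

end CoCartesian

/-- The components of an isomorphism of 1-morphisms. -/
def isoApp {A B : TwoVectTensor.{u, v, w} k} {F G : A ⟶ B} (e : F ≅ G) (j : B.base.Nonbase) :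
    (F.comp j).functor ≅ reindex A e.hom.base_eq j ⋙ (G.comp j).functor :=
  NatIso.ofComponents (fun X =>
    { hom := (e.hom.app j).app X
      inv := (e.inv.app j).app ((reindex A e.hom.base_eq j).obj X)
      hom_inv_id :=
        congrArg (fun α : Hom₂ F F => show (F.comp j).functor.obj X ⟶ (F.comp j).functor.obj X from
          (α.app j).app X) e.hom_inv_id
      inv_hom_id :=
        let Y := (reindex A e.hom.base_eq j).obj X
        congrArg (fun α : Hom₂ G G => show (G.comp j).functor.obj Y ⟶ (G.comp j).functor.obj Y from
          (α.app j).app Y) e.inv_hom_id }) fun f => (e.hom.app j).naturality f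

/-- A 1-morphism over an inert map of pointed sets: every element of the target other than the base
point has a unique preimage `sec l`. Such a map forgets the other entries of a list. -/
structure Inert {A X : TwoVectTensor.{u, v, w} k} (p : A ⟶ X) where
  sec : X.base.Nonbase → A.base.Nonbase
  fiber : ∀ l, p.base.toFun (sec l).1 = l.1
  unique : ∀ l (x : FinPt.Fiber p.base l), ⟨sec l, fiber l⟩ = x

namespace Inert

variable {A X : TwoVectTensor.{u, v, w} k} {p : A ⟶ X} (I : Inert p)

include I in
theorem surjective : Function.Surjective p.base.toFun := fun x => by
  by_cases h : x = X.base.pt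
  · exact ⟨A.base.pt, h ▸ p.base.map_pt⟩
  · exact ⟨(I.sec ⟨x, h⟩).1, I.fiber ⟨x, h⟩⟩

/-- The components of a 1-morphism over an inert map, as functors of one variable. -/
def unaryComp (l : X.base.Nonbase) : Tot (A.fam (I.sec l)) ⥤ Tot (X.fam l) :=
  (p.comp l).unary ⟨I.sec l, I.fiber l⟩ (I.unique l)

instance (l : X.base.Nonbase) : (I.unaryComp l).Additive :=
  inferInstanceAs ((p.comp l).unary _ _).Additive

instance (l : X.base.Nonbase) : (I.unaryComp l).Linear k :=
  inferInstanceAs (((p.comp l).unary _ _).Linear k)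

/-- The list of the entries of `A` which survive in `X`. -/
abbrev entries : TwoVectTensor.{u, v, w} k :=
  ⟨X.base, fun l => A.fam (I.sec l)⟩

/-- The 1-morphism which forgets the entries of `A` which do not survive in `X`. -/
def forget : A ⟶ I.entries :=
  Hom.mk (B := I.entries) p.base fun l =>
    MultiFun.ofUnary (fun i : FinPt.Fiber p.base l => A.fam i.1) ⟨I.sec l, I.fiber l⟩ (I.unique l)
      (𝟭 _) ⟨0, fun X m hm => ⟨m, hm, by simp⟩⟩

/-- The 1-morphism over the identity with the same components as `p`. -/
def entriesHom : I.entries ⟶ X :=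
  Hom.mk (A := I.entries) (𝟙 X.base) fun l =>
    MultiFun.ofUnary (fun i : FinPt.Fiber (𝟙 X.base) l => A.fam (I.sec i.1)) ⟨l, rfl⟩
      (fun x => (fiber_id_eq x).symm) (I.unaryComp l) (MultiFun.isBounded_unary _ _ _)

/-- A 1-morphism over an inert map factors through the projection to the surviving entries. -/
def forgetCompIso : I.forget ≫ I.entriesHom ≅ p :=
  isoMk (F := I.forget ≫ I.entriesHom) (G := p) rfl fun l =>
    ((p.comp l).isoUnary ⟨I.sec l, I.fiber l⟩ (I.unique l)).symm

theorem exists_inverse_entriesHom (hp : IsCoCartesian p) :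
    ∃ G : X ⟶ I.entries, G.base = 𝟙 X.base ∧ Nonempty (p ≫ G ≅ I.forget) ∧
      Nonempty (G ≫ I.entriesHom ≅ 𝟙 X) := by
  obtain ⟨G, ⟨θ⟩⟩ := hp.mem_essImage_precomp I.forget (𝟙 X.base) rfl
  have base_eq : G.base = 𝟙 X.base := FinPt.hom_ext <| I.surjective.forall.2 fun i =>
    congrArg (fun φ => φ.toFun i) θ.hom.base_eq
  have := hp.faithful_precomp X
  have := hp.full_precomp I.surjective X
  let θ' : p ≫ G ≅ I.forget := θ
  exact ⟨G, base_eq, ⟨θ'⟩, ⟨(precomp X p).preimageIso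
    ((α_ p G _).symm ≪≫ whiskerRightIso θ' _ ≪≫ I.forgetCompIso ≪≫ (ρ_ p).symm)⟩⟩

theorem isEquivalence_unaryComp (hp : IsCoCartesian p) (l : X.base.Nonbase) :
    (I.unaryComp l).IsEquivalence := by
  obtain ⟨⟨b, G⟩, hb, ⟨θ⟩, ⟨ω⟩⟩ := I.exists_inverse_entriesHom hp
  obtain rfl : b = 𝟙 X.base := hb
  have hl : ∀ x : FinPt.Fiber (𝟙 X.base) l, ⟨l, rfl⟩ = x := fun x => (fiber_id_eq x).symm
  let inverse : Tot (X.fam l) ⥤ Tot (A.fam (I.sec l)) := (G l).unary ⟨l, rfl⟩ hl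
  let G' : X ⟶ I.entries := Hom.mk (𝟙 X.base) G
  let evalA := Pi.eval (fun i : FinPt.Fiber p.base l => Tot (A.fam i.1)) ⟨I.sec l, I.fiber l⟩
  let evalX := Pi.eval (fun i : FinPt.Fiber (𝟙 X.base) l => Tot (X.fam i.1)) ⟨l, rfl⟩
  let θ' : evalA ⋙ I.unaryComp l ⋙ inverse ≅ evalA :=
    (compIsoUnary p G' (l := l) ⟨l, rfl⟩ hl ⟨I.sec l, I.fiber l⟩ (I.unique l)).symm ≪≫ isoApp θ l
  let ω' : evalX ⋙ inverse ⋙ I.unaryComp l ≅ evalX :=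
    (compIsoUnary G' I.entriesHom (l := l) ⟨l, rfl⟩ hl ⟨l, rfl⟩ hl).symm ≪≫ isoApp ω l
  let unitIso : I.unaryComp l ⋙ inverse ≅ 𝟭 _ :=
    Functor.isoWhiskerLeft (fromPoint _ _ (I.unique l)) θ'
  let counitIso : inverse ⋙ I.unaryComp l ≅ 𝟭 _ :=
    Functor.isoWhiskerLeft (fromPoint _ _ hl) ω'
  exact (CategoryTheory.Equivalence.mk _ _ unitIso.symm counitIso).isEquivalence_functor

end Inert

end TwoVectTensor

/-! ### Pairs of complementary inert 1-morphisms -/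

theorem bijective_whiskerLeft_whiskerRight {𝒲 𝒳 𝒴 𝒵 : Type*} [Category* 𝒲] [Category* 𝒳]
    [Category* 𝒴] [Category* 𝒵] (E : 𝒲 ⥤ 𝒳) [E.IsEquivalence] (F : 𝒴 ⥤ 𝒵) [F.Full] [F.Faithful]
    (S T : 𝒳 ⥤ 𝒴) :
    Function.Bijective fun t : S ⟶ T => Functor.whiskerLeft E (Functor.whiskerRight t F) :=
  ((Functor.FullyFaithful.ofFullyFaithful ((Functor.whiskeringLeft _ _ 𝒵).obj E)).map_bijective
    _ _).comp <|
  (Functor.FullyFaithful.ofFullyFaithful ((Functor.whiskeringRight 𝒳 _ _).obj F)).map_bijective S T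

namespace TwoVectTensor

namespace Inert

variable {A X : TwoVectTensor.{u, v, w} k} {p : A ⟶ X} (I : Inert p)

theorem eq_sec {l : X.base.Nonbase} {j : A.base.Nonbase} (h : p.base.toFun j.1 = l.1) :
    j = I.sec l :=
  congrArg (fun x : FinPt.Fiber p.base l => x.1) (I.unique l ⟨j, h⟩).symm

theorem sec_injective : Function.Injective I.sec := fun l l' h =>
  Subtype.ext (by rw [← I.fiber l, h, I.fiber l'])

include I in
theorem injOn {a b : A.base.carrier} (ha : p.base.toFun a ≠ X.base.pt)
    (h : p.base.toFun a = p.base.toFun b) : a = b := by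
  have ne_pt {c : A.base.carrier} (hc : p.base.toFun c = p.base.toFun a) : c ≠ A.base.pt :=
    fun e => ha (by rw [← hc, e, p.base.map_pt])
  have ha' := I.eq_sec (l := ⟨_, ha⟩) (j := ⟨a, ne_pt rfl⟩) rfl
  have hb' := I.eq_sec (l := ⟨_, ha⟩) (j := ⟨b, ne_pt h.symm⟩) h.symm
  exact congrArg Subtype.val (ha'.trans hb'.symm)

variable {Z : TwoVectTensor.{u, v, w} k} {G G' : Z ⟶ A}

theorem base_comp_eq_iff {b : Z.base ⟶ A.base} (l : X.base.Nonbase) (i : Z.base.Nonbase) :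
    (b ≫ p.base).toFun i.1 = l.1 ↔ b.toFun i.1 = (I.sec l).1 := by
  refine ⟨fun h => I.injOn (fun e => l.2 (h.symm.trans e)) (h.trans (I.fiber l).symm), fun h => ?_⟩
  exact (congrArg p.base.toFun h).trans (I.fiber l)

/-- Families indexed by a fibre of `G` and by the corresponding fibre of `G ≫ p`, where `p` lies
over an inert map. -/
def restrictEquivalence (G : Z ⟶ A) (l : X.base.Nonbase) :
    (∀ i : FinPt.Fiber (G ≫ p).base l, Tot (Z.fam i.1)) ≌
      ∀ i : FinPt.Fiber G.base (I.sec l), Tot (Z.fam i.1) :=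
  CategoryTheory.Equivalence.mk (restrict G p l ⟨I.sec l, I.fiber l⟩)
    { obj := fun W i => W ⟨i.1, (I.base_comp_eq_iff l i.1).1 i.2⟩
      map := fun f i => f ⟨i.1, (I.base_comp_eq_iff l i.1).1 i.2⟩ } (Iso.refl _) (Iso.refl _)

/-- The component of `τ ▷ p` at `l` determined by the component `t` of `τ` at `sec l`. -/
def whiskerAt (h : G.base = G'.base) (l : X.base.Nonbase)
    (t : (G.comp (I.sec l)).functor ⟶ reindex Z h (I.sec l) ⋙ (G'.comp (I.sec l)).functor) :
    ((G ≫ p).comp l).functor ⟶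
      reindex Z (congrArg (· ≫ p.base) h) l ⋙ ((G' ≫ p).comp l).functor :=
  (compIso G p ⟨I.sec l, I.fiber l⟩ (I.unique l)).hom ≫
    Functor.whiskerLeft (I.restrictEquivalence G l).functor
      (Functor.whiskerRight t (I.unaryComp l)) ≫
    Functor.whiskerLeft (reindex Z (congrArg (· ≫ p.base) h) l)
      (compIso G' p ⟨I.sec l, I.fiber l⟩ (I.unique l)).inv

theorem bijective_whiskerAt (hp : IsCoCartesian p) (h : G.base = G'.base) (l : X.base.Nonbase) :
    Function.Bijective (I.whiskerAt h l) := by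
  have := I.isEquivalence_unaryComp hp l
  have h' : G.base ≫ p.base = G'.base ≫ p.base := congrArg (· ≫ p.base) h
  let conj := (Iso.homCongr (compIso G p ⟨I.sec l, I.fiber l⟩ (I.unique l))
    (Functor.isoWhiskerLeft (reindex Z h' l)
      (compIso G' p ⟨I.sec l, I.fiber l⟩ (I.unique l)))).symm
  exact conj.bijective.comp
    (bijective_whiskerLeft_whiskerRight (I.restrictEquivalence G l).functor (I.unaryComp l) _ _)

theorem whiskerRight_app (τ : G ⟶ G') (l : X.base.Nonbase) :
    (τ ▷ p).app l = I.whiskerAt τ.base_eq l (τ.app (I.sec l)) := by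
  ext W
  exact (p.comp l).map_eq_unary_map ⟨I.sec l, I.fiber l⟩ (I.unique l) _

end Inert

/-- Two inert 1-morphisms such that every element other than the base point survives in exactly one
of the targets. -/
structure Complementary {A X Y : TwoVectTensor.{u, v, w} k} {p : A ⟶ X} {q : A ⟶ Y} (I : Inert p)
    (J : Inert q) : Prop where
  cover : ∀ j, (∃ l, I.sec l = j) ∨ ∃ l, J.sec l = j
  snd_fst : ∀ l, q.base.toFun (I.sec l).1 = Y.base.pt
  fst_snd : ∀ l, p.base.toFun (J.sec l).1 = X.base.pt

namespace Complementary

variable {A X Y : TwoVectTensor.{u, v, w} k} {p : A ⟶ X} {q : A ⟶ Y} {I : Inert p} {J : Inert q}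
  (H : Complementary I J)

include H

theorem sec_ne (l : X.base.Nonbase) (l' : Y.base.Nonbase) : I.sec l ≠ J.sec l' := fun h =>
  l'.2 <| by rw [← J.fiber l', ← h, H.snd_fst l]

theorem bijective_sumElim : Function.Bijective (Sum.elim I.sec J.sec) :=
  ⟨I.sec_injective.sumElim J.sec_injective H.sec_ne, fun j =>
    (H.cover j).elim (fun ⟨l, hl⟩ => ⟨.inl l, hl⟩) fun ⟨l, hl⟩ => ⟨.inr l, hl⟩⟩

theorem existsUnique_pi {P : A.base.Nonbase → Type*} (a : ∀ l, P (I.sec l))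
    (b : ∀ l, P (J.sec l)) :
    ∃! f : ∀ j, P j, (∀ l, f (I.sec l) = a l) ∧ ∀ l, f (J.sec l) = b l := by
  let e := Equiv.ofBijective _ H.bijective_sumElim
  refine ⟨Equiv.piCongrLeft P e fun x => x.rec a b, ⟨fun l => ?_, fun l => ?_⟩, fun f hf => ?_⟩
  · exact Equiv.piCongrLeft_apply_apply P e _ (.inl l)
  · exact Equiv.piCongrLeft_apply_apply P e _ (.inr l)
  · refine (Equiv.eq_symm_apply (Equiv.piCongrLeft P e).symm).2 (funext fun x => ?_)
    cases x with
    | inl l => exact hf.1 l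
    | inr l => exact hf.2 l

theorem eq_pt {a : A.base.carrier} (ha : p.base.toFun a = X.base.pt)
    (ha' : q.base.toFun a = Y.base.pt) : a = A.base.pt := by
  by_contra h
  obtain ⟨l, hl⟩ | ⟨l, hl⟩ := H.cover ⟨a, h⟩
  · exact l.2 (by rw [← I.fiber l, hl, ha])
  · exact l.2 (by rw [← J.fiber l, hl, ha'])

theorem base_hom_ext {K : FinPt} {f g : K ⟶ A.base} (hp : f ≫ p.base = g ≫ p.base)
    (hq : f ≫ q.base = g ≫ q.base) : f = g := by
  refine FinPt.hom_ext fun i => ?_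
  have hp : p.base.toFun (f.toFun i) = p.base.toFun (g.toFun i) :=
    congrArg (fun φ => φ.toFun i) hp
  have hq : q.base.toFun (f.toFun i) = q.base.toFun (g.toFun i) :=
    congrArg (fun φ => φ.toFun i) hq
  by_cases h : p.base.toFun (f.toFun i) = X.base.pt
  · by_cases h' : q.base.toFun (f.toFun i) = Y.base.pt
    · rw [H.eq_pt h h', H.eq_pt (hp.symm.trans h) (hq.symm.trans h')]
    · exact J.injOn h' hq
  · exact I.injOn h hp

variable (hp : IsCoCartesian p) (hq : IsCoCartesian q) {Z : TwoVectTensor.{u, v, w} k}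
  {G G' : Z ⟶ A}

include hp hq

theorem existsUnique_whiskerRight_eq (τ₁ : G ≫ p ⟶ G' ≫ p) (τ₂ : G ≫ q ⟶ G' ≫ q) :
    ∃! τ : G ⟶ G', τ ▷ p = τ₁ ∧ τ ▷ q = τ₂ := by
  have h : G.base = G'.base := H.base_hom_ext τ₁.base_eq τ₂.base_eq
  choose t₁ ht₁ using fun l => (I.bijective_whiskerAt hp h l).2 (τ₁.app l)
  choose t₂ ht₂ using fun l => (J.bijective_whiskerAt hq h l).2 (τ₂.app l)
  obtain ⟨t, ⟨e₁, e₂⟩, t_unique⟩ := H.existsUnique_pi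
    (P := fun j => (G.comp j).functor ⟶ reindex Z h j ⋙ (G'.comp j).functor) t₁ t₂
  refine ⟨Hom₂.mk h t, ⟨Hom₂.ext (funext fun l => ?_), Hom₂.ext (funext fun l => ?_)⟩, ?_⟩
  · rw [I.whiskerRight_app, ← ht₁, ← e₁]
  · rw [J.whiskerRight_app, ← ht₂, ← e₂]
  · rintro τ ⟨rfl, rfl⟩
    refine Hom₂.ext (t_unique _ ⟨fun l => ?_, fun l => ?_⟩)
    · exact (I.bijective_whiskerAt hp h l).1 ((I.whiskerRight_app τ l).symm.trans (ht₁ l).symm)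
    · exact (J.bijective_whiskerAt hq h l).1 ((J.whiskerRight_app τ l).symm.trans (ht₂ l).symm)

theorem isIso_of_isIso_whiskerRight (τ : G ⟶ G') [IsIso (τ ▷ p)] [IsIso (τ ▷ q)] : IsIso τ := by
  obtain ⟨σ, ⟨h1, h2⟩, -⟩ := H.existsUnique_whiskerRight_eq hp hq (inv (τ ▷ p)) (inv (τ ▷ q))
  refine ⟨σ, (H.existsUnique_whiskerRight_eq hp hq (𝟙 _) (𝟙 _)).unique ⟨?_, ?_⟩
    ⟨id_whiskerRight _ _, id_whiskerRight _ _⟩,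
    (H.existsUnique_whiskerRight_eq hp hq (𝟙 _) (𝟙 _)).unique ⟨?_, ?_⟩
    ⟨id_whiskerRight _ _, id_whiskerRight _ _⟩⟩
  all_goals simp [h1, h2]

end Complementary

end TwoVectTensor

/-- A multilinear functor, with its variables selected by an equivalent predicate. -/
def MultiFun.congrPred {ι : Type} {C : ι → TwoVectGr.{u, v, w} k} {D : TwoVectGr.{u, v, w} k}
    {P Q : ι → Prop} (h : ∀ i, P i ↔ Q i) (M : MultiFun (fun i : Subtype P => C i.1) D) :
    MultiFun (fun i : Subtype Q => C i.1) D where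
  functor := Functor.pi' (fun i : Subtype P => Pi.eval _ (⟨i.1, (h i.1).1 i.2⟩ : Subtype Q)) ⋙
    M.functor
  multilinear := by
    obtain rfl : P = Q := funext fun i => propext (h i)
    exact M.multilinear
  bounded := by
    obtain rfl : P = Q := funext fun i => propext (h i)
    exact M.bounded

theorem hom_ext_of_nonbase {K L : FinPt} {f g : K ⟶ L}
    (h : ∀ i : K.Nonbase, f.toFun i.1 = g.toFun i.1) : f = g :=
  FinPt.hom_ext fun i => by
    by_cases hi : i = K.pt
    · rw [hi, f.map_pt, g.map_pt]
    · exact h ⟨i, hi⟩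

namespace TwoVectTensor

namespace Inert

variable {A X Z : TwoVectTensor.{u, v, w} k} {p : A ⟶ X} (I : Inert p)

open Classical in
/-- The section of an inert map of pointed sets. -/
noncomputable def secHom : X.base ⟶ A.base :=
  ⟨fun x => if h : x = X.base.pt then A.base.pt else (I.sec ⟨x, h⟩).1, dif_pos rfl⟩

theorem secHom_toFun (l : X.base.Nonbase) : I.secHom.toFun l.1 = (I.sec l).1 :=
  dif_neg l.2

/-- The components of a 1-morphism to the entries of `A` which survive in `X`, as components of a
1-morphism to `A`. -/
def liftComp {b : Z.base ⟶ A.base} {g : Z ⟶ I.entries} (hg : g.base = b ≫ p.base)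
    (l : X.base.Nonbase) :
    MultiFun (fun i : FinPt.Fiber b (I.sec l) => Z.fam i.1) (A.fam (I.sec l)) :=
  (g.comp l).congrPred fun i => by
    rw [hg]
    exact I.base_comp_eq_iff l i

theorem nonempty_comp_forget_iso {f : Z ⟶ A} {g : Z ⟶ I.entries} (hg : g.base = f.base ≫ p.base)
    (h : ∀ l, f.comp (I.sec l) = I.liftComp hg l) : Nonempty (f ≫ I.forget ≅ g) :=
  ⟨isoMk (F := f ≫ I.forget) hg.symm fun l =>
    Functor.isoWhiskerLeft (restrict f I.forget l ⟨I.sec l, I.fiber l⟩)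
      (eqToIso (congrArg MultiFun.functor (h l)))⟩

theorem exists_comp_entriesHom_iso (hp : IsCoCartesian p) (f : Z ⟶ X) :
    ∃ g : Z ⟶ I.entries, g.base = f.base ∧ Nonempty (g ≫ I.entriesHom ≅ f) := by
  obtain ⟨G, hG, -, ⟨ω⟩⟩ := I.exists_inverse_entriesHom hp
  exact ⟨f ≫ G, (congrArg (f.base ≫ ·) hG).trans (Category.comp_id _),
    ⟨α_ _ _ _ ≪≫ whiskerLeftIso f ω ≪≫ ρ_ f⟩⟩

end Inert

namespace Complementary

variable {A X Y Z : TwoVectTensor.{u, v, w} k} {p : A ⟶ X} {q : A ⟶ Y} {I : Inert p} {J : Inert q}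

theorem exists_lift (H : Complementary I J) (hp : IsCoCartesian p) (hq : IsCoCartesian q)
    (b : Z.base ⟶ A.base) (f₁ : Z ⟶ X) (f₂ : Z ⟶ Y) (h₁ : f₁.base = b ≫ p.base)
    (h₂ : f₂.base = b ≫ q.base) :
    ∃ f : Z ⟶ A, Nonempty (f ≫ p ≅ f₁) ∧ Nonempty (f ≫ q ≅ f₂) := by
  obtain ⟨g₁, hg₁, ⟨ω₁⟩⟩ := I.exists_comp_entriesHom_iso hp f₁
  obtain ⟨g₂, hg₂, ⟨ω₂⟩⟩ := J.exists_comp_entriesHom_iso hq f₂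
  obtain ⟨M, ⟨hM₁, hM₂⟩, -⟩ := H.existsUnique_pi
    (P := fun j => MultiFun (fun i : FinPt.Fiber b j => Z.fam i.1) (A.fam j))
    (I.liftComp (hg₁.trans h₁)) (J.liftComp (hg₂.trans h₂))
  let f : Z ⟶ A := Hom.mk b M
  obtain ⟨θ₁⟩ := I.nonempty_comp_forget_iso (f := f) (hg₁.trans h₁) hM₁
  obtain ⟨θ₂⟩ := J.nonempty_comp_forget_iso (f := f) (hg₂.trans h₂) hM₂
  exact ⟨f, ⟨whiskerLeftIso f I.forgetCompIso.symm ≪≫ (α_ _ _ _).symm ≪≫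
    whiskerRightIso θ₁ _ ≪≫ ω₁⟩, ⟨whiskerLeftIso f J.forgetCompIso.symm ≪≫ (α_ _ _ _).symm ≪≫
    whiskerRightIso θ₂ _ ≪≫ ω₂⟩⟩

theorem exists_insertion (H : Complementary I J) (hp : IsCoCartesian p) (hq : IsCoCartesian q)
    (Φ : nil ⟶ X) : ∃ f : Y ⟶ A, Nonempty (f ≫ p ≅ toNil Y ≫ Φ) ∧ Nonempty (f ≫ q ≅ 𝟙 Y) := by
  refine H.exists_lift hp hq J.secHom _ _ (hom_ext_of_nonbase fun l => ?_)
    (hom_ext_of_nonbase fun l => ?_)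
  · exact Φ.base.map_pt.trans
      ((congrArg p.base.toFun (J.secHom_toFun l)).trans (H.fst_snd l)).symm
  · exact ((congrArg q.base.toFun (J.secHom_toFun l)).trans (J.fiber l)).symm

end Complementary

end TwoVectTensor

/-! ### Strongly coCartesian morphisms of families of finite sets -/

theorem existsUnique_pi_of_bijective {α β : Type*} {P : β → Type*} {e : α → β}
    (he : Function.Bijective e) (v : ∀ x, P (e x)) :
    ∃! w : ∀ z, P z, ∀ x, w (e x) = v x :=
  ⟨Equiv.piCongrLeft P (Equiv.ofBijective e he) v,
    Equiv.piCongrLeft_apply_apply P (Equiv.ofBijective e he) v, fun _ hw => funext <|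
      he.2.forall.2 fun x => (hw x).trans
        (Equiv.piCongrLeft_apply_apply P (Equiv.ofBijective e he) v x).symm⟩

namespace FinSetSqcup

variable {X Y Z : FinSetSqcup}

/-- The map induced by a morphism of families on the disjoint unions of their members, defined on
the members over elements which do not go to the base point. -/
def total (f : X ⟶ Y) :
    (Σ i : {i : X.base.Nonbase // f.base.toFun i.1 ≠ Y.base.pt}, (X.fam i.1 : Type)) →
      Σ j : Y.base.Nonbase, (Y.fam j : Type) :=
  fun x => ⟨⟨f.base.toFun x.1.1.1, x.1.2⟩, f.map x.1.1 x.1.2 x.2⟩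

/-- The possible values of a morphism over `g` at an element `z` of a member of `Y`. There is a
single one, carrying no information, if `g` takes the index of that member to the base point. -/
abbrev Value (g : Y.base ⟶ Z.base) (z : Σ j : Y.base.Nonbase, (Y.fam j : Type)) : Type :=
  ∀ h : g.toFun z.1.1 ≠ Z.base.pt, (Z.fam ⟨g.toFun z.1.1, h⟩ : Type)

/-- The morphism over `g` with given values at the elements of the members of `Y`. -/
def homOfValues (g : Y.base ⟶ Z.base) (w : ∀ z, Value g z) : Y ⟶ Z :=
  Hom.mk g fun j h => FintypeCat.homMk fun y => w ⟨j, y⟩ h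

theorem comp_homOfValues_eq_iff (f : X ⟶ Y) (g : Y.base ⟶ Z.base) (w : ∀ z, Value g z)
    (μ : ∀ (i : X.base.Nonbase) (h : (f.base ≫ g).toFun i.1 ≠ Z.base.pt),
      X.fam i ⟶ Z.fam ⟨(f.base ≫ g).toFun i.1, h⟩) :
    f ≫ homOfValues g w = Hom.mk (f.base ≫ g) μ ↔
      ∀ x, w (total f x) = fun h => μ x.1.1 h x.2 := by
  refine ⟨fun e x => funext fun h => ?_, fun e => Hom.ext rfl (heq_of_eq ?_)⟩
  · have maps_eq := congrFun (congrFun (eq_of_heq (Hom.mk.inj e).2) x.1.1) h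
    exact congrArg (fun t => t x.2) maps_eq
  · funext i h
    refine FintypeCat.hom_ext _ _ fun x => ?_
    exact congrFun (e ⟨⟨i, fun e => h ((congrArg g.toFun e).trans g.map_pt)⟩, x⟩) h

theorem base_eq_of_isHomLift {b : X.base ⟶ Y.base} {f : X ⟶ Y}
    (_ : proj.IsHomLift b f) : f.base = b :=
  (IsHomLift.fac' proj b f).trans ((Category.id_comp _).trans (Category.comp_id _))

theorem isStronglyCocartesian_of_bijective (f : X ⟶ Y)
    (hf : Function.Bijective (total f)) : proj.IsStronglyCocartesian f.base f where
  toIsHomLift := .map f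
  universal_property' := by
    rintro Z g ⟨b, μ⟩ lift
    obtain rfl : b = f.base ≫ g := base_eq_of_isHomLift lift
    obtain ⟨w, hw, w_unique⟩ := existsUnique_pi_of_bijective (P := Value g) hf
      fun x (h : g.toFun (f.base.toFun x.1.1.1) ≠ Z.base.pt) => μ x.1.1 h x.2
    refine ⟨homOfValues g w, ⟨Functor.IsHomLift.map (p := proj) (homOfValues g w),
      (comp_homOfValues_eq_iff f g w μ).2 hw⟩, ?_⟩
    rintro ⟨g', ν⟩ ⟨lift', hν⟩
    obtain rfl : g' = g := base_eq_of_isHomLift lift'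
    have values_eq := w_unique (fun z h => ν z.1 h z.2)
      ((comp_homOfValues_eq_iff f g' (fun z h => ν z.1 h z.2) μ).1 hν)
    exact congrArg (homOfValues g') values_eq

theorem isStronglyCocartesian_of_inert (f : X ⟶ Y) (s : Y.base.Nonbase → X.base.Nonbase)
    (hs : ∀ l i, f.base.toFun i.1 = l.1 ↔ s l = i)
    (hf : ∀ i h, Function.Bijective (f.map i h)) : proj.IsStronglyCocartesian f.base f := by
  refine isStronglyCocartesian_of_bijective f ⟨?_, ?_⟩
  · rintro ⟨⟨i, hi⟩, x⟩ ⟨⟨j, hj⟩, y⟩ e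
    have base_eq : f.base.toFun i.1 = f.base.toFun j.1 :=
      congrArg (fun z : Sigma fun j => (Y.fam j : Type) => z.1.1) e
    obtain rfl : i = j :=
      ((hs ⟨_, hi⟩ i).1 rfl).symm.trans ((hs ⟨_, hi⟩ j).1 base_eq.symm)
    obtain rfl := (hf i hi).1 (eq_of_heq (Sigma.mk.inj e).2)
    rfl
  · rintro ⟨l, y⟩
    obtain ⟨i, hi, rfl⟩ : ∃ i : X.base.Nonbase, ∃ hi, l = ⟨f.base.toFun i.1, hi⟩ :=
      have fiber := (hs l _).2 rfl
      ⟨s l, fun e => l.2 (fiber.symm.trans e), Subtype.ext fiber.symm⟩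
    obtain ⟨x, rfl⟩ := (hf i hi).2 y
    exact ⟨⟨⟨i, hi⟩, x⟩, rfl⟩

theorem isStronglyCocartesian_cop {S T : FintypeCat.{0}} (f₁ f₂ : S ⟶ T)
    (hf : Function.Bijective (Sum.elim f₁ f₂)) :
    proj.IsStronglyCocartesian (cop f₁ f₂).base (cop f₁ f₂) := by
  refine isStronglyCocartesian_of_bijective _ ⟨?_, ?_⟩
  · rintro ⟨⟨⟨i, hi⟩, hi'⟩, x⟩ ⟨⟨⟨j, hj⟩, hj'⟩, y⟩ e
    have e' := congrArg (fun z : Σ _ : (list 1 T).base.Nonbase, (T : Type) => z.2) e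
    change Fin 3 at i j
    fin_cases i <;> fin_cases j
    any_goals exact (hi rfl).elim
    any_goals exact (hj rfl).elim
    · obtain rfl := Sum.inl_injective (hf.1 (a₁ := .inl x) (a₂ := .inl y) e')
      rfl
    · exact (Sum.inl_ne_inr (hf.1 (a₁ := .inl x) (a₂ := .inr y) e')).elim
    · exact (Sum.inr_ne_inl (hf.1 (a₁ := .inr x) (a₂ := .inl y) e')).elim
    · obtain rfl := Sum.inr_injective (hf.1 (a₁ := .inr x) (a₂ := .inr y) e')
      rfl
  · rintro ⟨⟨j, hj⟩, z⟩
    change Fin 2 at j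
    fin_cases j
    · exact (hj rfl).elim
    · obtain ⟨x | x, rfl⟩ := hf.2 z
      · exact ⟨⟨⟨⟨(1 : Fin 3), (by decide : (1 : Fin 3) ≠ 0)⟩, hj⟩, x⟩, rfl⟩
      · exact ⟨⟨⟨⟨(2 : Fin 3), (by decide : (2 : Fin 3) ≠ 0)⟩, hj⟩, x⟩, rfl⟩

theorem fstEntry_base_iff (S : FintypeCat.{0}) (l : (list 1 S).base.Nonbase)
    (i : (list 2 S).base.Nonbase) :
    (fstEntry S).base.toFun i.1 = l.1 ↔
      (⟨(1 : Fin 3), (by decide : (1 : Fin 3) ≠ 0)⟩ : (list 2 S).base.Nonbase) = i := by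
  rw [Subtype.ext_iff]
  exact (by decide : ∀ (l : Fin 2) (i : Fin 3), l ≠ 0 → i ≠ 0 →
    ((![0, 1, 0] : Fin 3 → Fin 2) i = l ↔ 1 = i)) l.1 i.1 l.2 i.2

theorem sndEntry_base_iff (S : FintypeCat.{0}) (l : (list 1 S).base.Nonbase)
    (i : (list 2 S).base.Nonbase) :
    (sndEntry S).base.toFun i.1 = l.1 ↔
      (⟨(2 : Fin 3), (by decide : (2 : Fin 3) ≠ 0)⟩ : (list 2 S).base.Nonbase) = i := by
  rw [Subtype.ext_iff]
  exact (by decide : ∀ (l : Fin 2) (i : Fin 3), l ≠ 0 → i ≠ 0 →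
    ((![0, 0, 1] : Fin 3 → Fin 2) i = l ↔ 2 = i)) l.1 i.1 l.2 i.2

theorem isStronglyCocartesian_fstEntry (S : FintypeCat.{0}) :
    proj.IsStronglyCocartesian (fstEntry S).base (fstEntry S) :=
  isStronglyCocartesian_of_inert _ _ (fstEntry_base_iff S) fun _ _ => Function.bijective_id

theorem isStronglyCocartesian_sndEntry (S : FintypeCat.{0}) :
    proj.IsStronglyCocartesian (sndEntry S).base (sndEntry S) :=
  isStronglyCocartesian_of_inert _ _ (sndEntry_base_iff S) fun _ _ => Function.bijective_id

end FinSetSqcup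

namespace SSH

open FinSetSqcup TwoVectTensor

theorem isStronglyCocartesian_c : proj.IsStronglyCocartesian c.base c :=
  isStronglyCocartesian_cop _ _
    (by decide : Function.Bijective (Sum.elim (fun _ : Fin 1 => (0 : Fin 2)) fun _ : Fin 1 => 1))

theorem isStronglyCocartesian_cBar : proj.IsStronglyCocartesian cBar.base cBar :=
  isStronglyCocartesian_cop _ _
    (by decide : Function.Bijective (Sum.elim (![0, 2] : Fin 2 → Fin 4) ![1, 3]))

theorem isPullback_fold : IsPullback foldBar foldSq fold fold := by
  refine ⟨⟨rfl⟩, ⟨Limits.PullbackCone.IsLimit.mk _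
    (fun s => FintypeCat.homMk fun x =>
      (![![0, 2], ![1, 3]] : Fin 2 → Fin 2 → Fin 4) (s.fst x) (s.snd x)) ?_ ?_ ?_⟩⟩
  · intro s
    refine FintypeCat.hom_ext _ _ fun x => ?_
    exact (by decide : ∀ a b : Fin 2, (![0, 1, 0, 1] : Fin 4 → Fin 2)
      ((![![0, 2], ![1, 3]] : Fin 2 → Fin 2 → Fin 4) a b) = a) (s.fst x) (s.snd x)
  · intro s
    refine FintypeCat.hom_ext _ _ fun x => ?_
    exact (by decide : ∀ a b : Fin 2, (![0, 0, 1, 1] : Fin 4 → Fin 2)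
      ((![![0, 2], ![1, 3]] : Fin 2 → Fin 2 → Fin 4) a b) = b) (s.fst x) (s.snd x)
  · intro s m h1 h2
    refine FintypeCat.hom_ext _ _ fun x => ?_
    have h1 : foldBar (m x) = s.fst x := congrArg (fun t => t x) h1
    have h2 : foldSq (m x) = s.snd x := congrArg (fun t => t x) h2
    refine Eq.trans ?_ (congrArg₂ (![![0, 2], ![1, 3]] : Fin 2 → Fin 2 → Fin 4) h1 h2)
    exact (by decide : ∀ a : Fin 4, a = (![![0, 2], ![1, 3]] : Fin 2 → Fin 2 → Fin 4)
      ((![0, 1, 0, 1] : Fin 4 → Fin 2) a) ((![0, 0, 1, 1] : Fin 4 → Fin 2) a)) (m x)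

variable (𝓗 : SSH.{u, v, w} k)

/-- The identification of the base of the image of `X` with the base of `X`. -/
def baseEquiv (X : FinSetSqcup) : (𝓗.H.obj ⟨X⟩).base.carrier ≃ X.base.carrier where
  toFun := (𝓗.baseIso X).hom.toFun
  invFun := (𝓗.baseIso X).inv.toFun
  left_inv a := congrArg (fun f => f.toFun a) (𝓗.baseIso X).hom_inv_id
  right_inv a := congrArg (fun f => f.toFun a) (𝓗.baseIso X).inv_hom_id

variable {X Y : FinSetSqcup} (f : X ⟶ Y)

theorem baseEquiv_map (a : (𝓗.H.obj ⟨X⟩).base.carrier) :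
    𝓗.baseEquiv Y ((𝓗.H.map f.toLoc).base.toFun a) = f.base.toFun (𝓗.baseEquiv X a) :=
  congrArg (fun f => f.toFun a) (𝓗.baseIso_naturality f)

theorem map_base : (𝓗.H.map f.toLoc).base.toFun =
    (𝓗.baseEquiv Y).symm ∘ f.base.toFun ∘ 𝓗.baseEquiv X :=
  funext fun a => ((𝓗.baseEquiv Y).symm_apply_eq.2 (𝓗.baseEquiv_map f a).symm).symm

theorem bijective_map_base (h : Function.Bijective f.base.toFun) :
    Function.Bijective (𝓗.H.map f.toLoc).base.toFun := by
  rw [map_base]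
  exact (Equiv.bijective _).comp (h.comp (Equiv.bijective _))

theorem surjective_map_base (h : Function.Surjective f.base.toFun) :
    Function.Surjective (𝓗.H.map f.toLoc).base.toFun := by
  rw [map_base]
  exact (Equiv.surjective _).comp (h.comp (Equiv.surjective _))

theorem baseEquiv_eq_pt_iff {a : (𝓗.H.obj ⟨X⟩).base.carrier} :
    𝓗.baseEquiv X a = X.base.pt ↔ a = (𝓗.H.obj ⟨X⟩).base.pt := by
  rw [← (𝓗.baseIso X).hom.map_pt]
  exact (𝓗.baseEquiv X).apply_eq_iff_eq

/-- The identification of the complements of the base points. -/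
def nonbaseEquiv (X : FinSetSqcup) : (𝓗.H.obj ⟨X⟩).base.Nonbase ≃ X.base.Nonbase :=
  (𝓗.baseEquiv X).subtypeEquiv fun _ => 𝓗.baseEquiv_eq_pt_iff.not.symm

/-- The image of a morphism over an inert map is inert. -/
def inertMap (s : Y.base.Nonbase → X.base.Nonbase)
    (hs : ∀ l i, f.base.toFun i.1 = l.1 ↔ s l = i) : Inert (𝓗.H.map f.toLoc) where
  sec l := (𝓗.nonbaseEquiv X).symm (s (𝓗.nonbaseEquiv Y l))
  fiber l := by
    refine (𝓗.baseEquiv Y).injective ((𝓗.baseEquiv_map f _).trans ?_)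
    refine (congrArg (fun i => f.base.toFun (Subtype.val i))
      ((𝓗.nonbaseEquiv X).apply_symm_apply (s (𝓗.nonbaseEquiv Y l)))).trans ?_
    exact (hs (𝓗.nonbaseEquiv Y l) _).2 rfl
  unique l x := by
    refine Subtype.ext ((Equiv.symm_apply_eq _).2 ((hs _ _).1 ?_))
    exact (𝓗.baseEquiv_map f _).symm.trans (congrArg (𝓗.baseEquiv Y) x.2)

variable (S T : FintypeCat.{0})

/-- The 1-morphism which forgets the second entry is inert. -/
def inertFst : Inert (𝓗.H.map (fstEntry S).toLoc) :=
  𝓗.inertMap (fstEntry S) (fun _ => ⟨(1 : Fin 3), (by decide : (1 : Fin 3) ≠ 0)⟩)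
    (fstEntry_base_iff S)

/-- The 1-morphism which forgets the first entry is inert. -/
def inertSnd : Inert (𝓗.H.map (sndEntry S).toLoc) :=
  𝓗.inertMap (sndEntry S) (fun _ => ⟨(2 : Fin 3), (by decide : (2 : Fin 3) ≠ 0)⟩)
    (sndEntry_base_iff S)

theorem complementary_entries : Complementary (𝓗.inertFst S) (𝓗.inertSnd S) where
  cover j := by
    have h := (by decide : ∀ i : Fin 3, i ≠ 0 → 1 = i ∨ 2 = i) _ (𝓗.nonbaseEquiv (list 2 S) j).2
    refine h.imp (fun h => ⟨𝓗.one S, ?_⟩) (fun h => ⟨𝓗.one S, ?_⟩)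
    all_goals exact (Equiv.symm_apply_eq _).2 (Subtype.ext h)
  snd_fst l := by
    refine 𝓗.baseEquiv_eq_pt_iff.1 ((𝓗.baseEquiv_map (sndEntry S) _).trans ?_)
    exact congrArg (sndEntry S).base.toFun ((𝓗.baseEquiv (list 2 S)).apply_symm_apply (1 : Fin 3))
  fst_snd l := by
    refine 𝓗.baseEquiv_eq_pt_iff.1 ((𝓗.baseEquiv_map (fstEntry S) _).trans ?_)
    exact congrArg (fstEntry S).base.toFun ((𝓗.baseEquiv (list 2 S)).apply_symm_apply (2 : Fin 3))

theorem isCoCartesian_fst : IsCoCartesian (𝓗.H.map (fstEntry S).toLoc) :=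
  𝓗.coCartesian _ (isStronglyCocartesian_fstEntry S)

theorem isCoCartesian_snd : IsCoCartesian (𝓗.H.map (sndEntry S).toLoc) :=
  𝓗.coCartesian _ (isStronglyCocartesian_sndEntry S)

theorem nonempty_insertion (Φ : nil ⟶ 𝓗.ob 1 S) : Nonempty (𝓗.Insertion Φ) := by
  obtain ⟨f, ⟨e₁⟩, ⟨e₂⟩⟩ := (𝓗.complementary_entries S).exists_insertion (𝓗.isCoCartesian_fst S)
    (𝓗.isCoCartesian_snd S) Φ
  exact ⟨f, e₁, e₂⟩

variable {S T}

theorem surjective_map_cop_base (f₁ f₂ : S ⟶ T) :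
    Function.Surjective (𝓗.H.map (cop f₁ f₂).toLoc).base.toFun :=
  𝓗.surjective_map_base _ (by decide : Function.Surjective (![0, 1, 1] : Fin 3 → Fin 2))

theorem bijective_map_diag_base (n : ℕ) (f : S ⟶ T) :
    Function.Bijective (𝓗.H.map (diag n f).toLoc).base.toFun :=
  𝓗.bijective_map_base _ Function.bijective_id

theorem bijective_base_of_ne {g : 𝓗.ob 1 S ⟶ 𝓗.ob 1 T}
    (h : g.base.toFun (𝓗.one S).1 ≠ (𝓗.ob 1 T).base.pt) : Function.Bijective g.base.toFun := by
  have key : ∀ a, g.base.toFun a = (𝓗.ob 1 T).base.pt ↔ a = (𝓗.ob 1 S).base.pt := fun a =>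
    ⟨fun e => by_contra fun ha => h (by rwa [← 𝓗.eq_one S ⟨a, ha⟩]),
      fun e => e ▸ g.base.map_pt⟩
  refine ⟨fun a b e => ?_, fun y => ?_⟩
  · by_cases ha : a = (𝓗.ob 1 S).base.pt
    · rw [ha, eq_comm, ← key, ← e, key, ha]
    · have hb : b ≠ (𝓗.ob 1 S).base.pt := fun hb => ha (by rwa [← key, e, key])
      exact congrArg Subtype.val ((𝓗.eq_one S ⟨a, ha⟩).trans (𝓗.eq_one S ⟨b, hb⟩).symm)
  · by_cases hy : y = (𝓗.ob 1 T).base.pt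
    · exact ⟨(𝓗.ob 1 S).base.pt, hy ▸ g.base.map_pt⟩
    · exact ⟨(𝓗.one S).1, congrArg Subtype.val ((𝓗.eq_one T ⟨_, h⟩).trans
        (𝓗.eq_one T ⟨y, hy⟩).symm)⟩

theorem Insertion.bijective_base {Φ : nil ⟶ 𝓗.ob 1 S} (i : 𝓗.Insertion Φ) (f₁ f₂ : S ⟶ T) :
    Function.Bijective (i.hom ≫ 𝓗.H.map (cop f₁ f₂).toLoc).base.toFun := by
  refine 𝓗.bijective_base_of_ne fun h => ?_
  have h1 : (𝓗.H.map (sndEntry S).toLoc).base.toFun (i.hom.base.toFun (𝓗.one S).1) =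
      (𝓗.one S).1 := congrArg (fun φ => φ.toFun (𝓗.one S).1) i.snd.hom.base_eq
  have h2 : 𝓗.baseEquiv _ (i.hom.base.toFun (𝓗.one S).1) = (0 : Fin 3) :=
    (by decide : ∀ a : Fin 3, (![0, 1, 1] : Fin 3 → Fin 2) a = 0 → a = 0) _
      ((𝓗.baseEquiv_map (cop f₁ f₂) _).symm.trans (𝓗.baseEquiv_eq_pt_iff.2 h))
  have h3 := 𝓗.baseEquiv_eq_pt_iff.1 h2
  rw [h3] at h1
  exact (𝓗.one S).2 (h1.symm.trans (𝓗.H.map (sndEntry S).toLoc).base.map_pt)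

theorem nonempty_heisenbergData (F : Tot 𝓗.C) : Nonempty (𝓗.HeisenbergData F) := by
  obtain ⟨Δl, ⟨adjl⟩⟩ := exists_leftAdjoint 𝓗.m (𝓗.bijective_map_diag_base 1 fold)
  obtain ⟨Δr, ⟨adjr⟩⟩ := exists_rightAdjoint 𝓗.m (𝓗.bijective_map_diag_base 1 fold)
  obtain ⟨ΔrSq, ⟨adjrSq⟩⟩ := exists_rightAdjoint 𝓗.mSq (𝓗.bijective_map_diag_base 1 foldSq)
  obtain ⟨ins⟩ := 𝓗.nonempty_insertion _ (𝓗.pt F)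
  obtain ⟨insΔ⟩ := 𝓗.nonempty_insertion _ (𝓗.pt F ≫ Δl)
  obtain ⟨j, ⟨adjj⟩⟩ := exists_rightAdjoint (ins.hom ≫ 𝓗.H.map c.toLoc) (ins.bijective_base 𝓗 _ _)
  obtain ⟨jΔ, ⟨adjjΔ⟩⟩ := exists_rightAdjoint (insΔ.hom ≫ 𝓗.H.map cBar.toLoc)
    (insΔ.bijective_base 𝓗 _ _)
  exact ⟨⟨Δl, adjl, Δr, adjr, ΔrSq, adjrSq, ins, insΔ, j, adjj, jΔ, adjjΔ⟩⟩

end SSH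

namespace TwoVectTensor

theorem isIso_of_nil {A : TwoVectTensor.{u, v, w} k} {f g : A ⟶ nil} (θ : f ⟶ g) : IsIso θ :=
  ⟨Hom₂.mk θ.base_eq.symm fun j => (nil_false j).elim, by
    ext j : 2
    exact (nil_false j).elim, by
    ext j : 2
    exact (nil_false j).elim⟩

end TwoVectTensor

namespace SSH

open FinSetSqcup TwoVectTensor

namespace HeisenbergData

variable {𝓗 : SSH.{u, v, w} k} {F : Tot 𝓗.C} (D : 𝓗.HeisenbergData F)
  {τ : 𝓗.m ≫ D.ins.hom ⟶ D.insΔ.hom ≫ 𝓗.mm}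

theorem existsUnique_isUnitSquare : ∃! τ, D.IsUnitSquare τ := by
  simp only [IsUnitSquare, pasting_eq_iff]
  exact (𝓗.complementary_entries _).existsUnique_whiskerRight_eq (𝓗.isCoCartesian_fst _)
    (𝓗.isCoCartesian_snd _) _ _

theorem isIso_leftMate_whiskerRight_fstEntry (hτ : D.IsUnitSquare τ)
    {L : 𝓗.ob 2 (fset 1) ⟶ 𝓗.ob 2 (fset 2)} (adj : L ⊣ 𝓗.mm) :
    IsIso ((mateEquiv D.adjl adj).symm τ ▷ 𝓗.H.map (fstEntry (fset 2)).toLoc) := by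
  refine isIso_whiskerRight_leftMate D.adjl adj D.adjl τ
    (𝓗.H.isoMapOfCommSq (commSq_fstEntry fold).toLoc).hom ?_ ?_
  · exact isIso_leftMate_of_isCoCartesian _ _ _ (𝓗.isCoCartesian_fst _) (𝓗.inertFst _).surjective
      (𝓗.isCoCartesian_fst _) (𝓗.inertFst _).surjective
  · rw [vcomp_eq_of_pasting_eq _ D.insΔ.fst τ D.ins.fst.hom (𝟙 _ ⊗≫
      (toNilIso 𝓗.m).hom ▷ 𝓗.pt F ⊗≫ (toNil _ ≫ 𝓗.pt F) ◁ D.adjl.unit ⊗≫ 𝟙 _)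
      (hτ.1.trans (by simp [bicategoricalComp])), leftMate_comp, leftMate_unit]
    have := isIso_of_nil (D.adjl.homEquiv₁.symm (toNilIso 𝓗.m).hom)
    infer_instance

theorem isIso_leftMate_whiskerRight_sndEntry (hτ : D.IsUnitSquare τ)
    {L : 𝓗.ob 2 (fset 1) ⟶ 𝓗.ob 2 (fset 2)} (adj : L ⊣ 𝓗.mm) :
    IsIso ((mateEquiv D.adjl adj).symm τ ▷ 𝓗.H.map (sndEntry (fset 2)).toLoc) := by
  refine isIso_whiskerRight_leftMate D.adjl adj D.adjl τ
    (𝓗.H.isoMapOfCommSq (commSq_sndEntry fold).toLoc).hom ?_ ?_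
  · exact isIso_leftMate_of_isCoCartesian _ _ _ (𝓗.isCoCartesian_snd _) (𝓗.inertSnd _).surjective
      (𝓗.isCoCartesian_snd _) (𝓗.inertSnd _).surjective
  · rw [vcomp_eq_of_pasting_eq _ D.insΔ.snd τ D.ins.snd.hom ((ρ_ _).hom ≫ (λ_ _).inv)
      (hτ.2.trans (by simp [bicategoricalComp])), leftMate_comp]
    have := isIso_leftMate_unitors D.adjl
    infer_instance

theorem isIso_leftMate_of_isUnitSquare (hτ : D.IsUnitSquare τ)
    {L : 𝓗.ob 2 (fset 1) ⟶ 𝓗.ob 2 (fset 2)} (adj : L ⊣ 𝓗.mm) :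
    IsIso ((mateEquiv D.adjl adj).symm τ) := by
  have := D.isIso_leftMate_whiskerRight_fstEntry hτ adj
  have := D.isIso_leftMate_whiskerRight_sndEntry hτ adj
  exact (𝓗.complementary_entries _).isIso_of_isIso_whiskerRight (𝓗.isCoCartesian_fst _)
    (𝓗.isCoCartesian_snd _) _

theorem β_eq_vcomp : D.β τ =
    rightAdjointSquare.vcomp τ (𝓗.H.isoMapOfCommSq commSq_c.toLoc).hom := by
  simp [β, rightAdjointSquare.vcomp, bicategoricalComp]

theorem α_eq_hcomp : D.α τ =
    leftAdjointSquare.hcomp (D.β τ) (𝓗.H.isoMapOfCommSq commSq_fold.toLoc).hom := by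
  simp [α, leftAdjointSquare.hcomp, bicategoricalComp]

theorem rightBeckChevalley_β (hτ : D.IsUnitSquare τ) : RightBeckChevalley (D.β τ) := by
  obtain ⟨L, ⟨adj⟩⟩ := exists_leftAdjoint 𝓗.mm (𝓗.bijective_map_diag_base 2 fold)
  obtain ⟨L', ⟨adj'⟩⟩ := exists_leftAdjoint 𝓗.mBar (𝓗.bijective_map_diag_base 1 foldBar)
  refine RightBeckChevalley.of_isIso_leftMate D.adjl adj' ?_
  rw [β_eq_vcomp, leftMate_vcomp D.adjl adj adj', leftAdjointSquare.vcomp]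
  have := D.isIso_leftMate_of_isUnitSquare hτ adj
  have := isIso_leftMate_of_isCoCartesian adj adj' (𝓗.H.isoMapOfCommSq commSq_c.toLoc).hom
    (𝓗.coCartesian _ isStronglyCocartesian_c) (𝓗.surjective_map_cop_base _ _)
    (𝓗.coCartesian _ isStronglyCocartesian_cBar) (𝓗.surjective_map_cop_base _ _)
  infer_instance

theorem isIso_mate (hτ : D.IsUnitSquare τ) : IsIso (D.mate τ) := by
  have isIso_mate_hcomp := RightBeckChevalley.isIso_mateEquiv_hcomp (f := D.iΔ) (h := D.i)
    (i := 𝓗.mBar) (f' := 𝓗.mSq) (h' := 𝓗.m) D.adjjΔ D.adjj D.adjrSq D.adjr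
    (D.rightBeckChevalley_β hτ) (𝓗.beckChevalley isPullback_fold commSq_fold)
  rw [mate, α_eq_hcomp]
  with_reducible exact isIso_mate_hcomp

theorem rightBeckChevalley_α (hτ : D.IsUnitSquare τ) : RightBeckChevalley (D.α τ) := by
  have isIso_mate := D.isIso_mate hτ
  rw [mate] at isIso_mate
  with_reducible exact RightBeckChevalley.of_isIso_mateEquiv _ _ isIso_mate

end HeisenbergData

end SSH

end SelfAdjointHopf

theorem theorem5p2 {k : Type u} [Field k] (𝓗 : SelfAdjointHopf.SSH.{u, v, w} k)
    (F : SelfAdjointHopf.Tot 𝓗.C) :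
    Nonempty (𝓗.HeisenbergData F) ∧
    ∀ D : 𝓗.HeisenbergData F, ∃ τ : 𝓗.m ≫ D.ins.hom ⟶ D.insΔ.hom ≫ 𝓗.mm,
      D.IsUnitSquare τ ∧ (∀ τ', D.IsUnitSquare τ' → τ' = τ) ∧
      SelfAdjointHopf.RightBeckChevalley (D.β τ) ∧
      SelfAdjointHopf.RightBeckChevalley (D.α τ) ∧
      ∃ e : 𝓗.m ≫ D.ΔrF ≅ D.ΔrSqΔ ≫ 𝓗.m, e.inv = D.mate τ := by
  refine ⟨𝓗.nonempty_heisenbergData F, fun D => ?_⟩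
  obtain ⟨τ, hτ, huniq⟩ := D.existsUnique_isUnitSquare
  have := D.isIso_mate hτ
  exact ⟨τ, hτ, huniq, D.rightBeckChevalley_β hτ, D.rightBeckChevalley_α hτ,
    (asIso (D.mate τ)).symm, rfl⟩
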